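/- **Riesz representation.** Let $\mathbb{D}(0,r)=\{z\in\mathbb{C}:|z|<r\}$. A function $u:\Omega\to[-\infty,\infty)$ on an open set $\Omega\subset\mathbb{C}$ is called subharmonic if it is upper semicontinuous and $u(z_0)\le \frac{1}{2\pi}\int_0^{2\pi}u(z_0+re^{i\theta})\,d\theta$ whenever $r>0$ and $\overline{\mathbb{D}(z_0,r)}\subset\Omega$. There are a universal constant $C_0>0$ and, for every $\delta\in(0,1)$, a constant $C_0(\delta)>0$ depending only on $\delta$, such that the following holds. Let $u$ be subharmonic on some open neighborhood $\Omega$ of $\overline{\mathbb{D}(0,4)}$, and let $M,m\in\mathbb{R}$ be such that $u\le M$ on $\overline{\mathbb{D}(0,4)}$ and $u(0)\ge m$. Then there exist a finite positive Borel measure $\mu$ on $\mathbb{D}(0,3)$ and a harmonic function $h:\mathbb{D}(0,3)\to\mathbb{R}$ such that $$u(z)=\int_{\mathbb{D}(0,3)}\log|z-\zeta|\,\mu(d\zeta)+h(z)\qquad\text{for all } z\in\mathbb{D}(0,3),$$ as an identity in $[-\infty,\infty)$ (with $\log 0=-\infty$), and $$\mu(\mathbb{D}(0,3))\le C_0(M-m),\qquad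 \|h-M\|_{L^\infty(\mathbb{D}(0,2))}\le C_0(M-m),$$ $$\|h-M\|_{L^\infty(\mathbb{D}(0,3-\delta))}\le C_0(\delta)(M-m)\qquad\text{for every }\delta\in(0,1).$$ -/

import Mathlib

open MeasureTheory Set Metric

noncomputable section

/-- The integral of an extended-real-valued function, `∫ f⁺ dμ - ∫ f⁻ dμ` in `[-∞, ∞]`. It is the
usual (quasi-)integral of a measurable `f` as soon as one of the two parts is finite; below it is
only applied to functions that are bounded above, with respect to finite measures. -/
def extIntegral {α : Type*} [MeasurableSpace α] (μ : Measure α) (f : α → EReal) : EReal :=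
  ((∫⁻ x, (f x).toENNReal ∂μ : ENNReal) : EReal) - ((∫⁻ x, (-(f x)).toENNReal ∂μ : ENNReal) : EReal)

/-- The average `⨍_{∂D(c,r)} u` of an extended-real-valued function over the circle of centre `c`
and radius `r`, with respect to normalized arc length `dθ / (2π)`, `θ ∈ (0, 2π]`. -/
def circleMean (u : ℂ → EReal) (c : ℂ) (r : ℝ) : EReal :=
  extIntegral ((ENNReal.ofReal (2 * Real.pi))⁻¹ • (volume.restrict (Ioc 0 (2 * Real.pi))))
    (fun θ : ℝ => u (circleMap c r θ))

/-- `u` is subharmonic on the (open) set `Ω ⊆ ℂ`: it takes values in `[-∞, ∞)` there, is upper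
semicontinuous, and satisfies the sub-mean value property on all closed disks inside `Ω`.
Values of `u` outside `Ω` are irrelevant. -/
structure IsSubharmonicOn (u : ℂ → EReal) (Ω : Set ℂ) : Prop where
  lt_top : ∀ z ∈ Ω, u z < ⊤
  upperSemicontinuousOn : UpperSemicontinuousOn u Ω
  le_circleMean : ∀ (z : ℂ) (r : ℝ), 0 < r → closedBall z r ⊆ Ω → u z ≤ circleMean u z r

/-- The logarithmic potential `z ↦ ∫_D log|z - ζ| μ(dζ) ∈ [-∞, ∞)`, where `log 0 = -∞`. -/
def logPotential (D : Set ℂ) (μ : Measure ℂ) (z : ℂ) : EReal :=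
  extIntegral (μ.restrict D) (fun ζ => ENNReal.log ‖z - ζ‖ₑ)

end

/-!
Put `v = M - u ≥ 0` on the disk of radius `4`. Then `v` is lower semicontinuous and superharmonic,
and its super-mean value property at `0`, integrated in polar coordinates, gives
`∫ v ≤ 16 π (M - m)`. All estimates are linear in this integral, so no Harnack inequality is needed.

The Riesz measure is minus the distributional Laplacian of `v`, up to the factor `2π`. Let `A_r`
denote the average over circles of radius `r`. For test functions `g ≥ 0`, Tonelli's theorem turns
the inequality `A_r v ≤ v` into `∫ v (g - A_r g) ≥ 0`, and Taylor's formula gives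
`(A_r g - g) / r² → Δg / 4`. An ultrafilter limit of `(2 / π r²) ∫ v (χ g - A_r (χ g))` as `r → 0`,
for a cutoff `χ`, is thus a positive linear functional on all continuous `g` with compact support,
and equals `-(1 / 2π) ∫ v Δg` for smooth `g` supported where `χ = 1`. The Riesz–Markov–Kakutani
theorem represents it by a measure `μ` (`IsNonnegSuperharmonicOn.exists_measure_eq_laplacian`).

The potential of `μ` is computed with the test functions `χ(ζ) · ½ log (|ζ - z|² + s²)`. The
Laplacian of the logarithmic factor is `2π` times an explicit radial approximate identity, so it
contributes a mean of `v` that tends to `v z` as `s → 0`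
(`IsNonnegSuperharmonicOn.tendsto_lintegral_radialKernel`). The terms containing derivatives of `χ`
live in an annulus `13/4 ≤ |ζ| ≤ 7/2`, stay bounded, and in the limit give an integral that is
harmonic in `z` for `|z| < 3`. Monotone convergence on the other side yields the logarithm itself
(`IsRieszMeasure.lintegral_mul_logDefect`). The part of the weighted potential outside the disk of
radius `3` is harmonic inside it, with a bound that degenerates only at the boundary. Moving it to
the harmonic part leaves the potential of `μ` on the disk.
-/

section

open Filter Topology CompactlySupported

/-! ### Extended integrals of functions bounded above -/

/-- For a function bounded above by a constant on a finite measure space, the extended integral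
is the integral of the constant minus the (possibly infinite) integral of the nonnegative
difference. -/
theorem extIntegral_eq_sub_lintegral {α : Type*} [MeasurableSpace α] {μ : Measure α}
    [IsFiniteMeasure μ] {f : α → EReal} (hf : AEMeasurable f μ) {c : ℝ}
    (hc : ∀ᵐ x ∂μ, f x ≤ (c : EReal)) :
    extIntegral μ f = ((c * μ.real univ : ℝ) : EReal) -
      ((∫⁻ x, ((c : EReal) - f x).toENNReal ∂μ : ENNReal) : EReal) := by
  -- The identity `f⁺ + (c - f) + c⁻ = c⁺ + f⁻` is free of subtraction in `[0, ∞]` and so integrates.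
  have hpt : ∀ᵐ x ∂μ, (f x).toENNReal + ((c : EReal) - f x).toENNReal + ENNReal.ofReal (-c)
      = ENNReal.ofReal c + (-(f x)).toENNReal := by
    filter_upwards [hc] with x hx
    induction hfx : f x using EReal.rec with
    | bot => simp
    | top => rw [hfx] at hx; simp at hx
    | coe a =>
      rw [hfx] at hx
      have hx : a ≤ c := by exact_mod_cast hx
      rw [← EReal.coe_sub, ← EReal.coe_neg, EReal.toENNReal_of_ne_top (EReal.coe_ne_top _),
        EReal.toENNReal_of_ne_top (EReal.coe_ne_top _),
        EReal.toENNReal_of_ne_top (EReal.coe_ne_top _)]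
      simp only [EReal.toReal_coe]
      rcases le_total 0 a with ha | ha
      · rw [ENNReal.ofReal_of_nonpos (show -c ≤ 0 by linarith),
          ENNReal.ofReal_of_nonpos (show -a ≤ 0 by linarith),
          ← ENNReal.ofReal_add ha (by linarith)]
        simp
      · rw [ENNReal.ofReal_of_nonpos ha, zero_add]
        rcases le_total 0 c with h0 | h0
        · rw [ENNReal.ofReal_of_nonpos (show -c ≤ 0 by linarith), add_zero,
            ← ENNReal.ofReal_add h0 (by linarith)]
          congr 1
        · rw [ENNReal.ofReal_of_nonpos h0, zero_add,
            ← ENNReal.ofReal_add (by linarith) (by linarith)]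
          congr 1; ring
  have hfm : AEMeasurable (fun x => (f x).toENNReal) μ :=
    measurable_ereal_toENNReal.comp_aemeasurable hf
  have hdm : AEMeasurable (fun x => ((c : EReal) - f x).toENNReal) μ :=
    measurable_ereal_toENNReal.comp_aemeasurable (aemeasurable_const.sub hf)
  have key : (∫⁻ x, (f x).toENNReal ∂μ) + (∫⁻ x, ((c : EReal) - f x).toENNReal ∂μ) +
      ENNReal.ofReal (-c) * μ univ
      = ENNReal.ofReal c * μ univ + ∫⁻ x, (-(f x)).toENNReal ∂μ := by
    have := lintegral_congr_ae hpt
    rw [lintegral_add_right _ measurable_const, lintegral_add_left measurable_const,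
      lintegral_add_left' hfm] at this
    simpa using this
  have hP : (∫⁻ x, (f x).toENNReal ∂μ) ≠ ⊤ := by
    have : (∫⁻ x, (f x).toENNReal ∂μ) ≤ ∫⁻ x, ENNReal.ofReal c ∂μ := by
      apply lintegral_mono_ae
      filter_upwards [hc] with x hx
      simpa using EReal.toENNReal_le_toENNReal hx
    refine ne_top_of_le_ne_top ?_ this
    simp [ENNReal.mul_eq_top]
  unfold extIntegral
  have hm : μ univ = ENNReal.ofReal (μ.real univ) := by simp [Measure.real]
  have hm0 : 0 ≤ μ.real univ := measureReal_nonneg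
  generalize (∫⁻ x, (f x).toENNReal ∂μ) = P at *
  generalize (∫⁻ x, ((c : EReal) - f x).toENNReal ∂μ) = D at *
  generalize (∫⁻ x, (-(f x)).toENNReal ∂μ) = N at *
  rw [hm] at key
  generalize μ.real univ = a at *
  lift P to NNReal using hP
  induction D using ENNReal.recTopCoe with
  | top =>
    have : N = ⊤ := by
      by_contra h
      simp only [add_top, top_add] at key
      exact ENNReal.add_ne_top.2 ⟨ENNReal.mul_ne_top ENNReal.ofReal_ne_top
        ENNReal.ofReal_ne_top, h⟩ key.symm
    subst this
    simp
  | coe D =>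
    induction N using ENNReal.recTopCoe with
    | top =>
      rw [add_top] at key
      exact absurd key (ENNReal.add_ne_top.2 ⟨ENNReal.add_ne_top.2 ⟨by simp, by simp⟩,
        ENNReal.mul_ne_top ENNReal.ofReal_ne_top ENNReal.ofReal_ne_top⟩)
    | coe N =>
      have key' := congrArg ENNReal.toReal key
      rw [ENNReal.toReal_add (by finiteness) (by finiteness),
        ENNReal.toReal_add (by finiteness) (by finiteness),
        ENNReal.toReal_add (by finiteness) (by finiteness)] at key'
      simp only [ENNReal.coe_toReal, ENNReal.toReal_mul, ENNReal.toReal_ofReal hm0] at key'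
      have e1 : (ENNReal.ofReal c).toReal - (ENNReal.ofReal (-c)).toReal = c := by
        simp only [ENNReal.toReal_ofReal']
        rcases le_total 0 c with h | h
        · rw [max_eq_left h, max_eq_right (by linarith)]; ring
        · rw [max_eq_right h, max_eq_left (by linarith)]; ring
      have : (P : ℝ) - N = c * a - D := by
        have : c * a = (ENNReal.ofReal c).toReal * a - (ENNReal.ofReal (-c)).toReal * a := by
          rw [← sub_mul, e1]
        linarith
      have e2 : ∀ x : NNReal, (((x : ENNReal)) : EReal) = ((x : ℝ) : EReal) := fun x => rfl
      rw [e2, e2, e2, ← EReal.coe_sub, ← EReal.coe_sub, this]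

/-! ### Nonnegative superharmonic functions -/

/-- Nonnegative superharmonic functions on an open set `U`, in a form suited to integration:
a `[0, ∞]`-valued lower semicontinuous function on the whole plane whose mean over each circle
bounding a closed disk in `U` is at most its value at the centre. The values outside `U` only
enter through lower semicontinuity. -/
structure IsNonnegSuperharmonicOn (v : ℂ → ENNReal) (U : Set ℂ) : Prop where
  lsc : LowerSemicontinuous v
  lintegral_circleMap_le : ∀ (z : ℂ) (r : ℝ), 0 < r → closedBall z r ⊆ U →
    ∫⁻ θ in Ioc 0 (2 * Real.pi), v (circleMap z r θ) ≤ ENNReal.ofReal (2 * Real.pi) * v z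

theorem measurable_circleMap_uncurry (z : ℂ) :
    Measurable (fun p : ℝ × ℝ => circleMap z p.1 p.2) := by
  apply Continuous.measurable
  unfold circleMap
  fun_prop

/-- Polar coordinates centred at `z`. -/
theorem lintegral_eq_lintegral_circleMap {f : ℂ → ENNReal} (hf : Measurable f) (z : ℂ) :
    ∫⁻ ζ, f ζ = ∫⁻ r in Ioi (0 : ℝ), ENNReal.ofReal r *
      ∫⁻ θ in Ioc 0 (2 * Real.pi), f (circleMap z r θ) := by
  -- The reflection `ζ ↦ z - ζ` turns the angular range `(-π, π)` into `(0, 2π)`.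
  have h1 : ∫⁻ ζ, f ζ = ∫⁻ ζ, f (z - ζ) := (lintegral_sub_left_eq_self f z).symm
  rw [h1, ← Complex.lintegral_comp_polarCoord_symm]
  have ht : polarCoord.target = Ioi (0 : ℝ) ×ˢ Ioo (-Real.pi) Real.pi := rfl
  have hmeas : Measurable (fun p : ℝ × ℝ =>
      ENNReal.ofReal p.1 • f (z - Complex.polarCoord.symm p)) := by
    have : Measurable (fun p : ℝ × ℝ => z - Complex.polarCoord.symm p) := by
      apply Continuous.measurable
      simp only [Complex.polarCoord_symm_apply]
      fun_prop
    simp only [smul_eq_mul]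
    exact (ENNReal.measurable_ofReal.comp measurable_fst).mul (hf.comp this)
  rw [ht, Measure.volume_eq_prod, ← Measure.prod_restrict, lintegral_prod _ hmeas.aemeasurable]
  refine lintegral_congr fun r => ?_
  simp only [smul_eq_mul]
  have hm2 : Measurable (fun θ : ℝ => f (circleMap z r θ)) :=
    hf.comp (continuous_circleMap z r).measurable
  rw [lintegral_const_mul]
  · congr 1
    have hpre : (fun θ : ℝ => θ + Real.pi) ⁻¹' (Ioo 0 (2 * Real.pi)) = Ioo (-Real.pi) Real.pi := by
      ext θ
      simp only [mem_preimage, mem_Ioo]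
      constructor <;> rintro ⟨h1, h2⟩ <;> constructor <;> linarith
    rw [setLIntegral_congr Ioo_ae_eq_Ioc.symm, ← (measurePreserving_add_right volume
      Real.pi).setLIntegral_comp_preimage measurableSet_Ioo hm2, hpre]
    refine lintegral_congr fun θ => ?_
    congr 1
    simp only [circleMap, Complex.polarCoord_symm_apply, Complex.ofReal_add, add_mul,
      Complex.exp_add, Complex.exp_pi_mul_I]
    rw [Complex.exp_mul_I]
    push_cast
    ring
  · refine hf.comp ?_
    apply Continuous.measurable
    simp only [Complex.polarCoord_symm_apply]
    fun_prop

namespace IsNonnegSuperharmonicOn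

variable {v : ℂ → ENNReal} {U : Set ℂ}

theorem measurable (hv : IsNonnegSuperharmonicOn v U) : Measurable v := hv.lsc.measurable

/-- The super-mean value property for an arbitrary radial weight on a disk. -/
theorem lintegral_radial_le (hv : IsNonnegSuperharmonicOn v U) {z : ℂ} {R : ℝ}
    (hR : ball z R ⊆ U) {w : ℝ → ENNReal} (hw : Measurable w) :
    ∫⁻ ζ in ball z R, w ‖ζ - z‖ * v ζ ≤ v z * ∫⁻ ζ in ball z R, w ‖ζ - z‖ := by
  have hn : Measurable (fun ζ : ℂ => w ‖ζ - z‖) := by fun_prop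
  rw [← lintegral_indicator measurableSet_ball, ← lintegral_indicator measurableSet_ball,
    lintegral_eq_lintegral_circleMap (Measurable.indicator (f := fun ζ => w ‖ζ - z‖ * v ζ)
      (hn.mul hv.measurable) measurableSet_ball) z,
    lintegral_eq_lintegral_circleMap (hn.indicator measurableSet_ball) z,
    ← lintegral_const_mul _ ?_]
  · refine setLIntegral_mono' measurableSet_Ioi fun r hr => ?_
    have hr : 0 < r := hr
    have hnorm : ∀ θ : ℝ, ‖circleMap z r θ - z‖ = r := fun θ => by
      simp [circleMap, abs_of_pos hr]
    by_cases hrR : r < R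
    · have hmem : ∀ θ : ℝ, circleMap z r θ ∈ ball z R := fun θ => by
        rw [mem_ball_iff_norm, hnorm]; exact hrR
      simp only [indicator_of_mem (hmem _), hnorm]
      have hvm : Measurable fun θ : ℝ => v (circleMap z r θ) :=
        hv.measurable.comp (continuous_circleMap z r).measurable
      rw [lintegral_const_mul _ hvm]
      simp only [lintegral_const, MeasurableSet.univ, Measure.restrict_apply, univ_inter,
        Real.volume_Ioc, sub_zero]
      calc _ ≤ ENNReal.ofReal r * (w r * (ENNReal.ofReal (2 * Real.pi) * v z)) := by
            gcongr
            exact hv.lintegral_circleMap_le z r hr ((closedBall_subset_ball hrR).trans hR)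
        _ = _ := by ring
    · have hmem : ∀ θ : ℝ, circleMap z r θ ∉ ball z R := fun θ => by
        rw [mem_ball_iff_norm, hnorm]; exact hrR
      simp [indicator_of_notMem (hmem _)]
  · refine Measurable.mul ENNReal.measurable_ofReal ?_
    refine Measurable.lintegral_prod_right (f := fun r θ => (ball z R).indicator
      (fun ζ => w ‖ζ - z‖) (circleMap z r θ)) ?_
    exact (hn.indicator measurableSet_ball).comp (measurable_circleMap_uncurry z)

theorem lintegral_ball_le (hv : IsNonnegSuperharmonicOn v U) {z : ℂ} {R : ℝ}
    (hR : ball z R ⊆ U) : ∫⁻ ζ in ball z R, v ζ ≤ v z * volume (ball z R) := by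
  simpa using hv.lintegral_radial_le hR (w := fun _ => 1) measurable_const

end IsNonnegSuperharmonicOn

theorem EReal.coe_sub_toENNReal_coe_sub {c : ℝ} {x : EReal} (h : x ≤ (c : EReal)) :
    (c : EReal) - ((((c : EReal) - x).toENNReal : ENNReal) : EReal) = x := by
  rw [EReal.coe_toENNReal (by rw [EReal.sub_nonneg (.inl (by simp)) (.inl (by simp))]; exact h)]
  induction x using EReal.rec with
  | bot => simp
  | top => simp at h
  | coe a => rw [← EReal.coe_sub, ← EReal.coe_sub]; congr 1; ring

theorem EReal.continuous_coe_sub_toENNReal (c : ℝ) :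
    Continuous fun x : EReal => ((c : EReal) - x).toENNReal := by
  refine Continuous.ereal_toENNReal (continuous_iff_continuousAt.2 fun x => ?_)
  change ContinuousAt (fun x : EReal => (c : EReal) + -x) x
  exact ContinuousAt.comp (g := fun p : EReal × EReal => p.1 + p.2)
    (f := fun x : EReal => ((c : EReal), -x))
    (EReal.continuousAt_add (.inl (by simp)) (.inl (by simp)))
    (by fun_prop)

/-- Subtracting a subharmonic function from an upper bound, and cutting off outside a disk, gives
a nonnegative superharmonic function. -/
theorem IsSubharmonicOn.isNonnegSuperharmonicOn {u : ℂ → EReal} {Ω : Set ℂ}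
    (hu : IsSubharmonicOn u Ω) {c : ℂ} {R : ℝ} (hR : ball c R ⊆ Ω) {M : ℝ}
    (hM : ∀ z ∈ ball c R, u z ≤ (M : EReal)) :
    IsNonnegSuperharmonicOn ((ball c R).indicator fun z => ((M : EReal) - u z).toENNReal)
      (ball c R) := by
  set v := (ball c R).indicator fun z => ((M : EReal) - u z).toENNReal with hvdef
  have hlsc : LowerSemicontinuous v := by
    intro x y hy
    by_cases hx : x ∈ ball c R
    · rw [hvdef, indicator_of_mem hx] at hy
      have hanti : Antitone fun x : EReal => ((M : EReal) - x).toENNReal := fun a b hab =>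
        EReal.toENNReal_le_toENNReal (EReal.sub_le_sub le_rfl hab)
      have h1 := ((EReal.continuous_coe_sub_toENNReal M).comp_upperSemicontinuousOn_antitone
        (hu.upperSemicontinuousOn.mono hR) hanti) x hx y hy
      rw [isOpen_ball.nhdsWithin_eq hx] at h1
      filter_upwards [h1, isOpen_ball.mem_nhds hx] with w hw hwb
      rw [hvdef, indicator_of_mem hwb]
      exact hw
    · rw [hvdef, indicator_of_notMem hx] at hy
      simp at hy
  refine ⟨hlsc, fun z r hr hzr => ?_⟩
  have hmem : ∀ θ : ℝ, circleMap z r θ ∈ ball c R := fun θ =>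
    hzr (circleMap_mem_closedBall z hr.le θ)
  have hz : z ∈ ball c R := hzr (mem_closedBall_self hr.le)
  have hvu : ∀ w ∈ ball c R, (M : EReal) - (v w : EReal) = u w := fun w hw => by
    rw [hvdef, indicator_of_mem hw, EReal.coe_sub_toENNReal_coe_sub (hM w hw)]
  have hmean := hu.le_circleMean z r hr (hzr.trans hR)
  have hpi : ENNReal.ofReal (2 * Real.pi) ≠ 0 := by
    simp [Real.pi_pos]
  have hpi' : ENNReal.ofReal (2 * Real.pi) ≠ ⊤ := ENNReal.ofReal_ne_top
  have huniv : ((ENNReal.ofReal (2 * Real.pi))⁻¹ • (volume.restrict (Ioc 0 (2 * Real.pi))))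
      univ = 1 := by
    rw [Measure.smul_apply, Measure.restrict_apply_univ, Real.volume_Ioc, sub_zero, smul_eq_mul,
      ENNReal.inv_mul_cancel hpi hpi']
  have : IsFiniteMeasure
      ((ENNReal.ofReal (2 * Real.pi))⁻¹ • (volume.restrict (Ioc 0 (2 * Real.pi)))) :=
    ⟨by rw [huniv]; simp⟩
  have hmeas : Measurable fun θ : ℝ => u (circleMap z r θ) := by
    have : (fun θ : ℝ => u (circleMap z r θ)) =
        fun θ => (M : EReal) - (v (circleMap z r θ) : EReal) := by
      funext θ
      rw [hvu _ (hmem θ)]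
    rw [this]
    have := hlsc.measurable.comp (continuous_circleMap z r).measurable
    exact measurable_const.sub (measurable_coe_ennreal_ereal.comp this)
  rw [circleMean, extIntegral_eq_sub_lintegral (c := M) hmeas.aemeasurable
    (ae_of_all _ fun θ => hM _ (hmem θ)), Measure.real, huniv, ENNReal.toReal_one, mul_one,
    ← hvu z hz, lintegral_smul_measure, smul_eq_mul] at hmean
  have hcongr : ∫⁻ θ in Ioc 0 (2 * Real.pi), ((M : EReal) - u (circleMap z r θ)).toENNReal =
      ∫⁻ θ in Ioc 0 (2 * Real.pi), v (circleMap z r θ) :=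
    lintegral_congr fun θ => by rw [hvdef, indicator_of_mem (hmem θ)]
  rw [hcongr] at hmean
  have h2 : (ENNReal.ofReal (2 * Real.pi))⁻¹ * ∫⁻ θ in Ioc 0 (2 * Real.pi), v (circleMap z r θ)
      ≤ v z := by
    have := EReal.toENNReal_le_toENNReal (EReal.sub_le_sub (le_refl (M : EReal)) hmean)
    have hid : ∀ a : ENNReal, ((M : EReal) - ((M : EReal) - (a : EReal))).toENNReal = a := by
      intro a
      induction a using ENNReal.recTopCoe with
      | top => simp
      | coe a =>
        change ((M : EReal) - ((M : EReal) - ((a : ℝ) : EReal))).toENNReal = _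
        rw [← EReal.coe_sub, ← EReal.coe_sub, sub_sub_cancel]
        simp
    rwa [hid, hid] at this
  rwa [ENNReal.inv_mul_le_iff hpi hpi'] at h2

/-! ### Circle averages and the Laplacian -/

/-- The Laplacian in the plane as a trace of the second Fréchet derivative. -/
theorem laplacian_eq_fderiv_fderiv (f : ℂ → ℝ) (z : ℂ) :
    Laplacian.laplacian f z = fderiv ℝ (fderiv ℝ f) z 1 1
      + fderiv ℝ (fderiv ℝ f) z Complex.I Complex.I := by
  rw [InnerProductSpace.laplacian_eq_iteratedFDeriv_complexPlane]
  simp [iteratedFDeriv_two_apply]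

theorem ContDiff.fderiv_fderiv_continuous {f : ℂ → ℝ} (hf : ContDiff ℝ 2 f) :
    Continuous (fderiv ℝ (fderiv ℝ f)) :=
  (hf.fderiv_right (m := 1) (by norm_num)).continuous_fderiv one_ne_zero

theorem ContDiff.continuous_laplacian {f : ℂ → ℝ} (hf : ContDiff ℝ 2 f) :
    Continuous (Laplacian.laplacian f : ℂ → ℝ) := by
  have h := hf.fderiv_fderiv_continuous
  rw [funext (laplacian_eq_fderiv_fderiv f)]
  fun_prop

theorem ContDiff.hasFDerivAt_fderiv {f : ℂ → ℝ} (hf : ContDiff ℝ 2 f) (z : ℂ) :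
    HasFDerivAt (fderiv ℝ f) (fderiv ℝ (fderiv ℝ f) z) z :=
  ((hf.fderiv_right (m := 1) (by norm_num)).differentiable one_ne_zero z).hasFDerivAt

/-- Second order Taylor expansion with Lagrange remainder along a segment. -/
theorem ContDiff.exists_taylor_two {f : ℂ → ℝ} (hf : ContDiff ℝ 2 f) (z w : ℂ) :
    ∃ t ∈ Ioo (0 : ℝ) 1, f (z + w) - f z - fderiv ℝ f z w =
      2⁻¹ * fderiv ℝ (fderiv ℝ f) (z + t • w) w w := by
  have hl : ∀ t : ℝ, HasDerivAt (fun t : ℝ => z + t • w) w t := fun t => by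
    simpa using ((hasDerivAt_id t).smul_const w).const_add z
  have h1 : ∀ t : ℝ, HasDerivAt (fun t : ℝ => f (z + t • w)) (fderiv ℝ f (z + t • w) w) t :=
    fun t => ((hf.differentiable two_ne_zero _).hasFDerivAt).comp_hasDerivAt t (hl t)
  have h2 : ∀ t : ℝ, HasDerivAt (fun t : ℝ => fderiv ℝ f (z + t • w) w)
      (fderiv ℝ (fderiv ℝ f) (z + t • w) w w) t := fun t => by
    have := (hf.hasFDerivAt_fderiv (z + t • w)).comp_hasDerivAt t (hl t)
    exact ((ContinuousLinearMap.apply ℝ ℝ w).hasFDerivAt).comp_hasDerivAt t this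
  -- Cauchy's mean value theorem for `φ + (1 - t) φ'` against `-(1 - t)²`.
  have h3 : ∀ t : ℝ, HasDerivAt (fun t : ℝ => f (z + t • w) +
      (1 - t) * fderiv ℝ f (z + t • w) w)
      ((1 - t) * fderiv ℝ (fderiv ℝ f) (z + t • w) w w) t := fun t => by
    refine ((h1 t).add (((hasDerivAt_id t).const_sub 1).mul (h2 t))).congr_deriv ?_
    simp
  have h4 : ∀ t : ℝ, HasDerivAt (fun t : ℝ => -(1 - t) ^ 2) (2 * (1 - t)) t := fun t => by
    refine ((((hasDerivAt_id t).const_sub 1).pow 2).neg).congr_deriv ?_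
    simp
  obtain ⟨c, hc, hc'⟩ := exists_ratio_hasDerivAt_eq_ratio_slope _ _ zero_lt_one
    (fun t _ => (h3 t).continuousAt.continuousWithinAt) (fun t _ => h3 t) _ _
    (fun t _ => (h4 t).continuousAt.continuousWithinAt) (fun t _ => h4 t)
  refine ⟨c, hc, ?_⟩
  have hc1 : (1 - c) ≠ 0 := by have := hc.2; intro h; linarith
  simp only [sub_self, one_smul, zero_smul, add_zero, zero_mul, sub_zero, one_mul] at hc'
  have : (1 - c) * (2 * (f (z + w) - f z - fderiv ℝ f z w)) =
      (1 - c) * fderiv ℝ (fderiv ℝ f) (z + c • w) w w := by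
    linear_combination -hc'
  have := mul_left_cancel₀ hc1 this
  linarith

/-- The second difference quotient entering the circle average of `f` about `z`; the linear term
averages to zero. -/
noncomputable def circleQuotient (f : ℂ → ℝ) (z : ℂ) (r θ : ℝ) : ℝ :=
  (f (circleMap z r θ) - f z - fderiv ℝ f z (circleMap 0 r θ)) / r ^ 2

theorem integral_circleMap_zero (r : ℝ) : ∫ θ in (0 : ℝ)..2 * Real.pi, circleMap 0 r θ = 0 := by
  have h : ∀ θ ∈ uIcc (0 : ℝ) (2 * Real.pi),
      HasDerivAt (fun θ => -Complex.I * circleMap 0 r θ) (circleMap 0 r θ) θ := fun θ _ => by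
    refine ((hasDerivAt_circleMap 0 r θ).const_mul (-Complex.I)).congr_deriv ?_
    linear_combination (-circleMap 0 r θ) * Complex.I_sq
  rw [intervalIntegral.integral_eq_sub_of_hasDerivAt h
    ((continuous_circleMap 0 r).intervalIntegrable _ _)]
  simp [circleMap]

theorem circleAverage_sub_div_eq {f : ℂ → ℝ} (hf : Continuous f) (z : ℂ) (r : ℝ) :
    (Real.circleAverage f z r - f z) / r ^ 2 =
      (2 * Real.pi)⁻¹ * ∫ θ in (0 : ℝ)..2 * Real.pi, circleQuotient f z r θ := by
  have hpi := Real.pi_pos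
  have hc : Continuous fun θ => f (circleMap z r θ) := hf.comp (continuous_circleMap z r)
  have hl : Continuous fun θ => fderiv ℝ f z (circleMap 0 r θ) :=
    (fderiv ℝ f z).continuous.comp (continuous_circleMap 0 r)
  unfold circleQuotient
  have hcs : Continuous fun θ => f (circleMap z r θ) - f z := hc.sub continuous_const
  rw [intervalIntegral.integral_div, intervalIntegral.integral_sub
    (hcs.intervalIntegrable _ _) (hl.intervalIntegrable _ _),
    intervalIntegral.integral_sub (hc.intervalIntegrable _ _) (by simp),
    ContinuousLinearMap.intervalIntegral_comp_comm _
      ((continuous_circleMap 0 r).intervalIntegrable _ _), integral_circleMap_zero,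
    Real.circleAverage]
  simp only [intervalIntegral.integral_const, smul_eq_mul, map_zero]
  field_simp
  ring

theorem ContDiff.exists_circleQuotient_eq {f : ℂ → ℝ} (hf : ContDiff ℝ 2 f) (z : ℂ) {r : ℝ}
    (hr : 0 < r) (θ : ℝ) : ∃ ξ : ℂ, ‖ξ - z‖ ≤ r ∧ circleQuotient f z r θ =
      2⁻¹ * fderiv ℝ (fderiv ℝ f) ξ (circleMap 0 1 θ) (circleMap 0 1 θ) := by
  obtain ⟨t, ht, h⟩ := hf.exists_taylor_two z (circleMap 0 r θ)
  refine ⟨z + t • circleMap 0 r θ, ?_, ?_⟩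
  rotate_left
  · unfold circleQuotient
    have e1 : circleMap z r θ = z + circleMap 0 r θ := by simp [circleMap]
    have e2 : circleMap 0 r θ = r • circleMap 0 1 θ := by simp [circleMap]
    rw [e1, h]
    generalize z + t • circleMap 0 r θ = ξ
    rw [e2]
    simp only [map_smul, _root_.smul_apply, smul_eq_mul]
    field_simp
  · rw [add_sub_cancel_left, norm_smul, norm_circleMap_zero, abs_of_pos hr, Real.norm_eq_abs,
      abs_of_pos ht.1]
    nlinarith [ht.2]

theorem ContDiff.abs_circleQuotient_le {f : ℂ → ℝ} (hf : ContDiff ℝ 2 f) {C : ℝ}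
    (hC : ∀ z, ‖fderiv ℝ (fderiv ℝ f) z‖ ≤ C) (z : ℂ) {r : ℝ} (hr : 0 < r) (θ : ℝ) :
    |circleQuotient f z r θ| ≤ C := by
  obtain ⟨ξ, -, h⟩ := hf.exists_circleQuotient_eq z hr θ
  have h1 := (fderiv ℝ (fderiv ℝ f) ξ).le_opNorm₂ (circleMap 0 1 θ) (circleMap 0 1 θ)
  simp only [norm_circleMap_zero, abs_one, mul_one, Real.norm_eq_abs] at h1
  rw [h, abs_mul, abs_of_pos (by norm_num : (0 : ℝ) < 2⁻¹)]
  have := hC ξ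
  have := abs_nonneg (fderiv ℝ (fderiv ℝ f) ξ (circleMap 0 1 θ) (circleMap 0 1 θ))
  linarith

theorem continuous_circleQuotient {f : ℂ → ℝ} (hf : Continuous f) (z : ℂ) (r : ℝ) :
    Continuous (circleQuotient f z r) := by
  have hc : Continuous fun θ => f (circleMap z r θ) := hf.comp (continuous_circleMap z r)
  have hl : Continuous fun θ => fderiv ℝ f z (circleMap 0 r θ) :=
    (fderiv ℝ f z).continuous.comp (continuous_circleMap 0 r)
  exact ((hc.sub continuous_const).sub hl).div_const _

theorem ContDiff.abs_circleAverage_sub_div_le {f : ℂ → ℝ} (hf : ContDiff ℝ 2 f) {C : ℝ}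
    (hC : ∀ z, ‖fderiv ℝ (fderiv ℝ f) z‖ ≤ C) (z : ℂ) {r : ℝ} (hr : 0 < r) :
    |(Real.circleAverage f z r - f z) / r ^ 2| ≤ C := by
  have hpi := Real.pi_pos
  rw [circleAverage_sub_div_eq hf.continuous, abs_mul, abs_of_pos (by positivity)]
  have := intervalIntegral.norm_integral_le_of_norm_le_const (a := 0) (b := 2 * Real.pi)
    (f := circleQuotient f z r) (C := C)
    (fun θ _ => by simpa using hf.abs_circleQuotient_le hC z hr θ)
  rw [Real.norm_eq_abs, sub_zero, abs_of_pos (by positivity : 0 < 2 * Real.pi)] at this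
  rw [inv_mul_le_iff₀ (by positivity)]
  linarith

/-- Asymptotics of circle averages: `(⨍_{|ζ-z|=r} f - f z) / r² → Δf(z) / 4`. -/
theorem ContDiff.tendsto_circleAverage_sub_div {f : ℂ → ℝ} (hf : ContDiff ℝ 2 f) {C : ℝ}
    (hC : ∀ z, ‖fderiv ℝ (fderiv ℝ f) z‖ ≤ C) (z : ℂ) :
    Tendsto (fun r => (Real.circleAverage f z r - f z) / r ^ 2) (𝓝[>] 0)
      (𝓝 (Laplacian.laplacian f z / 4)) := by
  have hpi := Real.pi_pos
  simp only [circleAverage_sub_div_eq hf.continuous]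
  have hlim : Tendsto (fun r => ∫ θ in (0 : ℝ)..2 * Real.pi, circleQuotient f z r θ) (𝓝[>] 0)
      (𝓝 (∫ θ in (0 : ℝ)..2 * Real.pi,
        2⁻¹ * fderiv ℝ (fderiv ℝ f) z (circleMap 0 1 θ) (circleMap 0 1 θ))) := by
    refine intervalIntegral.tendsto_integral_filter_of_dominated_convergence (fun _ => C) ?_ ?_
      (by simp) ?_
    · exact Eventually.of_forall fun r =>
        (continuous_circleQuotient hf.continuous z r).aestronglyMeasurable
    · filter_upwards [self_mem_nhdsWithin] with r hr
      exact ae_of_all _ fun θ _ => hf.abs_circleQuotient_le hC z hr θ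
    · refine ae_of_all _ fun θ _ => ?_
      have h0 : ∀ r : ℝ, ∃ ξ : ℂ, 0 < r → ‖ξ - z‖ ≤ r ∧ circleQuotient f z r θ =
          2⁻¹ * fderiv ℝ (fderiv ℝ f) ξ (circleMap 0 1 θ) (circleMap 0 1 θ) := fun r => by
        by_cases hr : 0 < r
        · obtain ⟨ξ, h⟩ := hf.exists_circleQuotient_eq z hr θ
          exact ⟨ξ, fun _ => h⟩
        · exact ⟨0, fun h => absurd h hr⟩
      choose ξ hξ using h0
      have hξz : Tendsto ξ (𝓝[>] 0) (𝓝 z) := by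
        rw [tendsto_iff_norm_sub_tendsto_zero]
        refine squeeze_zero' (Eventually.of_forall fun _ => norm_nonneg _) ?_
          (tendsto_id.mono_left nhdsWithin_le_nhds)
        filter_upwards [self_mem_nhdsWithin] with r hr using (hξ r hr).1
      have hcont : Continuous fun ξ =>
          2⁻¹ * fderiv ℝ (fderiv ℝ f) ξ (circleMap 0 1 θ) (circleMap 0 1 θ) := by
        have := hf.fderiv_fderiv_continuous
        fun_prop
      refine ((hcont.tendsto z).comp hξz).congr' ?_
      filter_upwards [self_mem_nhdsWithin] with r hr using ((hξ r hr).2).symm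
  convert hlim.const_mul (2 * Real.pi)⁻¹ using 2
  rw [laplacian_eq_fderiv_fderiv]
  set B := fderiv ℝ (fderiv ℝ f) z
  have hB : ∀ θ : ℝ, 2⁻¹ * B (circleMap 0 1 θ) (circleMap 0 1 θ) =
      2⁻¹ * (B 1 1) * Real.cos θ ^ 2 + (2⁻¹ * (B 1 Complex.I + B Complex.I 1) *
        (Real.sin θ * Real.cos θ) + 2⁻¹ * (B Complex.I Complex.I) * Real.sin θ ^ 2) := fun θ => by
    have : circleMap 0 1 θ = Real.cos θ • (1 : ℂ) + Real.sin θ • Complex.I := by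
      simp [circleMap, Complex.exp_mul_I]
    rw [this]
    simp only [map_add, map_smul, _root_.add_apply, _root_.smul_apply,
      smul_eq_mul]
    ring
  simp only [hB]
  rw [intervalIntegral.integral_add, intervalIntegral.integral_add]
  · simp only [intervalIntegral.integral_const_mul, integral_cos_sq, integral_sin_sq,
      integral_sin_mul_cos₁]
    simp
    field_simp
    ring
  all_goals exact Continuous.intervalIntegrable (by fun_prop) _ _

/-! ### Moving circle averages onto test functions -/

theorem continuous_circleAverage {g : ℂ → ℝ} (hg : Continuous g) (r : ℝ) :
    Continuous fun z => Real.circleAverage g z r := by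
  unfold Real.circleAverage
  have : Continuous fun z => ∫ θ in (0 : ℝ)..2 * Real.pi, g (circleMap z r θ) := by
    refine intervalIntegral.continuous_parametric_intervalIntegral_of_continuous
      (μ := volume) (f := fun z θ => g (circleMap z r θ)) ?_ continuous_const
    refine hg.comp ?_
    unfold circleMap
    fun_prop
  simp only [smul_eq_mul]
  exact continuous_const.mul this

theorem abs_circleAverage_le {g : ℂ → ℝ} {B : ℝ} (hB : ∀ z, |g z| ≤ B) (z : ℂ) (r : ℝ) :
    |Real.circleAverage g z r| ≤ B := by
  have hpi := Real.pi_pos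
  have := intervalIntegral.norm_integral_le_of_norm_le_const (a := 0) (b := 2 * Real.pi)
    (f := fun θ => g (circleMap z r θ)) (C := B) (fun θ _ => by simpa using hB _)
  rw [Real.norm_eq_abs, sub_zero, abs_of_pos (by positivity : 0 < 2 * Real.pi)] at this
  rw [Real.circleAverage, smul_eq_mul, abs_mul, abs_of_pos (by positivity),
    inv_mul_le_iff₀ (by positivity)]
  linarith

theorem circleAverage_nonneg {g : ℂ → ℝ} (h0 : ∀ z, 0 ≤ g z) (z : ℂ) (r : ℝ) :
    0 ≤ Real.circleAverage g z r := by
  have hpi := Real.pi_pos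
  rw [Real.circleAverage, smul_eq_mul]
  exact mul_nonneg (by positivity)
    (intervalIntegral.integral_nonneg (by positivity) fun θ _ => h0 _)

theorem ofReal_circleAverage {g : ℂ → ℝ} (hg : Continuous g) (h0 : ∀ z, 0 ≤ g z) (z : ℂ) (r : ℝ) :
    ENNReal.ofReal (Real.circleAverage g z r) = (ENNReal.ofReal (2 * Real.pi))⁻¹ *
      ∫⁻ θ in Ioc 0 (2 * Real.pi), ENNReal.ofReal (g (circleMap z r θ)) := by
  have hpi := Real.pi_pos
  have hc : Continuous fun θ => g (circleMap z r θ) := hg.comp (continuous_circleMap z r)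
  rw [Real.circleAverage, smul_eq_mul, ENNReal.ofReal_mul (by positivity),
    ENNReal.ofReal_inv_of_pos (by positivity),
    intervalIntegral.integral_of_le (by positivity),
    ofReal_integral_eq_lintegral_ofReal (hc.integrableOn_Ioc) (ae_of_all _ fun θ => h0 _)]

/-- The difference quotient `(2 / (π r²)) ∫ v (g - A_r g)`, where `A_r` is the average over circles
of radius `r`. As `r → 0` it tends to `-(1 / 2π) ∫ v Δg`, and it is nonnegative for `g ≥ 0` when `v`
is superharmonic, because `A_r` is symmetric. -/
noncomputable def circlePairing (v : ℂ → ENNReal) (r : ℝ) (g : ℂ → ℝ) : ℝ :=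
  -(2 / Real.pi) * ∫ ζ, (v ζ).toReal * ((Real.circleAverage g ζ r - g ζ) / r ^ 2)

namespace IsNonnegSuperharmonicOn

variable {v : ℂ → ENNReal} {U : Set ℂ}

/-- The circle average is moved from the test function to `v` by Tonelli's theorem. -/
theorem lintegral_mul_circleAverage_le (hv : IsNonnegSuperharmonicOn v U) {g : ℂ → ℝ}
    (hg : Continuous g) (h0 : ∀ z, 0 ≤ g z) {r : ℝ} (hr : 0 < r)
    (hU : ∀ z, g z ≠ 0 → closedBall z r ⊆ U) :
    ∫⁻ ζ, v ζ * ENNReal.ofReal (Real.circleAverage g ζ r) ≤ ∫⁻ ζ, v ζ * ENNReal.ofReal (g ζ) := by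
  have hpi := Real.pi_pos
  have hpi0 : ENNReal.ofReal (2 * Real.pi) ≠ 0 := by simp [Real.pi_pos]
  have hpiT : ENNReal.ofReal (2 * Real.pi) ≠ ⊤ := ENNReal.ofReal_ne_top
  have hGm : Measurable fun ζ => ENNReal.ofReal (g ζ) :=
    ENNReal.measurable_ofReal.comp hg.measurable
  have hmap : Measurable fun p : ℂ × ℝ => p.1 - circleMap 0 r p.2 := by
    apply Continuous.measurable
    unfold circleMap
    fun_prop
  have hmap' : Measurable fun p : ℂ × ℝ => circleMap p.1 r p.2 := by
    apply Continuous.measurable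
    unfold circleMap
    fun_prop
  have hneg : ∀ ζ θ, circleMap ζ (-r) θ = ζ - circleMap 0 r θ := fun ζ θ => by
    simp [circleMap, sub_eq_add_neg]
  calc ∫⁻ ζ, v ζ * ENNReal.ofReal (Real.circleAverage g ζ r)
      = ∫⁻ ζ, (ENNReal.ofReal (2 * Real.pi))⁻¹ * ∫⁻ θ in Ioc 0 (2 * Real.pi),
          v ζ * ENNReal.ofReal (g (ζ - circleMap 0 r θ)) := by
        refine lintegral_congr fun ζ => ?_
        rw [← Real.circleAverage_neg_radius, ofReal_circleAverage hg h0]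
        simp only [hneg]
        rw [lintegral_const_mul]
        · ring
        · exact hGm.comp (hmap.comp measurable_prodMk_left)
    _ = (ENNReal.ofReal (2 * Real.pi))⁻¹ * ∫⁻ θ in Ioc 0 (2 * Real.pi), ∫⁻ ζ,
          v ζ * ENNReal.ofReal (g (ζ - circleMap 0 r θ)) := by
        have hm : Measurable fun p : ℂ × ℝ =>
            v p.1 * ENNReal.ofReal (g (p.1 - circleMap 0 r p.2)) :=
          (hv.measurable.comp measurable_fst).mul (hGm.comp hmap)
        rw [lintegral_const_mul _ hm.lintegral_prod_right',
          lintegral_lintegral_swap (f := fun ζ θ =>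
            v ζ * ENNReal.ofReal (g (ζ - circleMap 0 r θ))) hm.aemeasurable]
    _ = (ENNReal.ofReal (2 * Real.pi))⁻¹ * ∫⁻ θ in Ioc 0 (2 * Real.pi), ∫⁻ ζ,
          v (circleMap ζ r θ) * ENNReal.ofReal (g ζ) := by
        congr 1
        refine lintegral_congr fun θ => ?_
        rw [← lintegral_add_right_eq_self _ (circleMap 0 r θ)]
        refine lintegral_congr fun ζ => ?_
        rw [add_sub_cancel_right]
        simp [circleMap]
    _ = (ENNReal.ofReal (2 * Real.pi))⁻¹ * ∫⁻ ζ, (∫⁻ θ in Ioc 0 (2 * Real.pi),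
          v (circleMap ζ r θ)) * ENNReal.ofReal (g ζ) := by
        congr 1
        have hm : Measurable fun p : ℂ × ℝ =>
            v (circleMap p.1 r p.2) * ENNReal.ofReal (g p.1) :=
          (hv.measurable.comp hmap').mul (hGm.comp measurable_fst)
        rw [← lintegral_lintegral_swap (f := fun ζ θ =>
            v (circleMap ζ r θ) * ENNReal.ofReal (g ζ)) hm.aemeasurable]
        refine lintegral_congr fun ζ => ?_
        rw [lintegral_mul_const]
        exact hv.measurable.comp (hmap'.comp measurable_prodMk_left)
    _ ≤ (ENNReal.ofReal (2 * Real.pi))⁻¹ * ∫⁻ ζ, ENNReal.ofReal (2 * Real.pi) *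
          (v ζ * ENNReal.ofReal (g ζ)) := by
        refine mul_le_mul_right (lintegral_mono fun ζ => ?_) _
        by_cases hζ : g ζ = 0
        · simp [hζ]
        · rw [← mul_assoc]
          refine mul_le_mul_left ?_ _
          exact hv.lintegral_circleMap_le ζ r hr (hU ζ hζ)
    _ = _ := by
        have hm : Measurable fun ζ => v ζ * ENNReal.ofReal (g ζ) := hv.measurable.mul hGm
        rw [lintegral_const_mul _ hm, ← mul_assoc,
          ENNReal.inv_mul_cancel hpi0 hpiT, one_mul]

theorem integrable_toReal (hv : IsNonnegSuperharmonicOn v U) (hfin : ∫⁻ ζ, v ζ ≠ ⊤) :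
    Integrable fun ζ => (v ζ).toReal :=
  integrable_toReal_of_lintegral_ne_top hv.measurable.aemeasurable hfin

theorem integrable_toReal_mul (hv : IsNonnegSuperharmonicOn v U) (hfin : ∫⁻ ζ, v ζ ≠ ⊤)
    {g : ℂ → ℝ} (hg : AEStronglyMeasurable g volume) {B : ℝ} (hB : ∀ z, |g z| ≤ B) :
    Integrable fun ζ => (v ζ).toReal * g ζ :=
  (hv.integrable_toReal hfin).mul_bdd (c := B) hg (ae_of_all _ hB)

theorem integral_toReal_mul (hv : IsNonnegSuperharmonicOn v U) (hfin : ∫⁻ ζ, v ζ ≠ ⊤)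
    {g : ℂ → ℝ} (hg : Continuous g) (h0 : ∀ z, 0 ≤ g z) :
    ∫ ζ, (v ζ).toReal * g ζ = (∫⁻ ζ, v ζ * ENNReal.ofReal (g ζ)).toReal := by
  rw [integral_eq_lintegral_of_nonneg_ae (ae_of_all _ fun ζ =>
    mul_nonneg ENNReal.toReal_nonneg (h0 ζ))
    (hv.measurable.ennreal_toReal.mul hg.measurable).aestronglyMeasurable]
  congr 1
  refine lintegral_congr_ae ?_
  filter_upwards [ae_lt_top hv.measurable hfin] with ζ hζ
  rw [ENNReal.ofReal_mul ENNReal.toReal_nonneg, ENNReal.ofReal_toReal hζ.ne]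

theorem integrable_circlePairing (hv : IsNonnegSuperharmonicOn v U) (hfin : ∫⁻ ζ, v ζ ≠ ⊤)
    {g : ℂ → ℝ} (hg : Continuous g) (hgc : HasCompactSupport g) (r : ℝ) :
    Integrable fun ζ => (v ζ).toReal * ((Real.circleAverage g ζ r - g ζ) / r ^ 2) := by
  obtain ⟨B, hB⟩ := hg.bounded_above_of_compact_support hgc
  have hB' : ∀ z, |g z| ≤ B := fun z => by simpa using hB z
  refine hv.integrable_toReal_mul hfin (B := (B + B) / r ^ 2)
    (((continuous_circleAverage hg r).sub hg).div_const _).aestronglyMeasurable fun z => ?_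
  rw [abs_div, abs_of_nonneg (sq_nonneg r)]
  have := abs_sub (Real.circleAverage g z r) (g z)
  have := abs_circleAverage_le hB' z r
  have := hB' z
  gcongr
  linarith

theorem circlePairing_add (hv : IsNonnegSuperharmonicOn v U) (hfin : ∫⁻ ζ, v ζ ≠ ⊤)
    {g h : ℂ → ℝ} (hg : Continuous g) (hgc : HasCompactSupport g) (hh : Continuous h)
    (hhc : HasCompactSupport h) (r : ℝ) :
    circlePairing v r (fun z => g z + h z) = circlePairing v r g + circlePairing v r h := by
  unfold circlePairing
  rw [← mul_add, ← integral_add (hv.integrable_circlePairing hfin hg hgc r)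
    (hv.integrable_circlePairing hfin hh hhc r)]
  congr 2
  funext ζ
  have : Real.circleAverage (fun z => g z + h z) ζ r =
      Real.circleAverage g ζ r + Real.circleAverage h ζ r :=
    Real.circleAverage_fun_add (hg.continuousOn.circleIntegrable') (hh.continuousOn.circleIntegrable')
  rw [this]
  ring

end IsNonnegSuperharmonicOn

theorem circlePairing_const_mul (v : ℂ → ENNReal) (r c : ℝ) (g : ℂ → ℝ) :
    circlePairing v r (fun z => c * g z) = c * circlePairing v r g := by
  unfold circlePairing
  have : ∀ ζ, (v ζ).toReal * ((Real.circleAverage (fun z => c * g z) ζ r - c * g ζ) / r ^ 2) =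
      c * ((v ζ).toReal * ((Real.circleAverage g ζ r - g ζ) / r ^ 2)) := fun ζ => by
    have : Real.circleAverage (fun z => c * g z) ζ r = c * Real.circleAverage g ζ r := by
      simpa using Real.circleAverage_fun_smul (a := c) (f := g) (c := ζ) (R := r)
    rw [this]
    ring
  simp only [this]
  rw [integral_const_mul]
  ring

namespace IsNonnegSuperharmonicOn

variable {v : ℂ → ENNReal} {U : Set ℂ}

theorem circlePairing_nonneg (hv : IsNonnegSuperharmonicOn v U) (hfin : ∫⁻ ζ, v ζ ≠ ⊤)
    {g : ℂ → ℝ} (hg : Continuous g) (hgc : HasCompactSupport g) (h0 : ∀ z, 0 ≤ g z) {r : ℝ}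
    (hr : 0 < r) (hU : ∀ z, g z ≠ 0 → closedBall z r ⊆ U) : 0 ≤ circlePairing v r g := by
  obtain ⟨B, hB⟩ := hg.bounded_above_of_compact_support hgc
  have hB' : ∀ z, |g z| ≤ B := fun z => by simpa using hB z
  have h1 : ∫ ζ, (v ζ).toReal * Real.circleAverage g ζ r ≤ ∫ ζ, (v ζ).toReal * g ζ := by
    rw [hv.integral_toReal_mul hfin hg h0, hv.integral_toReal_mul hfin
      (continuous_circleAverage hg r) (fun z => circleAverage_nonneg h0 z r)]
    refine ENNReal.toReal_mono ?_ (hv.lintegral_mul_circleAverage_le hg h0 hr hU)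
    refine ne_top_of_le_ne_top (ENNReal.mul_ne_top hfin (ENNReal.ofReal_ne_top (r := B))) ?_
    rw [← lintegral_mul_const _ hv.measurable]
    refine lintegral_mono fun ζ => ?_
    gcongr
    exact (le_abs_self _).trans (hB' ζ)
  have h2 : ∫ ζ, (v ζ).toReal * ((Real.circleAverage g ζ r - g ζ) / r ^ 2) =
      ((∫ ζ, (v ζ).toReal * Real.circleAverage g ζ r) - ∫ ζ, (v ζ).toReal * g ζ) / r ^ 2 := by
    rw [← integral_sub, ← integral_div]
    · congr 1
      funext ζ
      ring
    · exact hv.integrable_toReal_mul hfin (continuous_circleAverage hg r).aestronglyMeasurable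
        (fun z => abs_circleAverage_le hB' z r)
    · exact hv.integrable_toReal_mul hfin hg.aestronglyMeasurable hB'
  rw [circlePairing, h2]
  have hpi := Real.pi_pos
  have : ((∫ ζ, (v ζ).toReal * Real.circleAverage g ζ r) - ∫ ζ, (v ζ).toReal * g ζ) / r ^ 2 ≤ 0 :=
    div_nonpos_of_nonpos_of_nonneg (by linarith) (sq_nonneg r)
  have h3 : 0 < 2 / Real.pi := by positivity
  nlinarith

end IsNonnegSuperharmonicOn

theorem ContDiff.exists_norm_fderiv_fderiv_le {f : ℂ → ℝ} (hf : ContDiff ℝ 2 f)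
    (hfc : HasCompactSupport f) : ∃ C, ∀ z, ‖fderiv ℝ (fderiv ℝ f) z‖ ≤ C := by
  have h1 : HasCompactSupport (fderiv ℝ f) := hfc.fderiv ℝ
  have h2 : HasCompactSupport (fderiv ℝ (fderiv ℝ f)) := h1.fderiv ℝ
  have h3 := hf.fderiv_fderiv_continuous
  generalize fderiv ℝ (fderiv ℝ f) = g at *
  have h4 := Continuous.bounded_above_of_compact_support (f := g) h3 h2
  exact h4

namespace IsNonnegSuperharmonicOn

variable {v : ℂ → ENNReal} {U : Set ℂ}

theorem exists_abs_circlePairing_le (hv : IsNonnegSuperharmonicOn v U) (hfin : ∫⁻ ζ, v ζ ≠ ⊤)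
    {f : ℂ → ℝ} (hf : ContDiff ℝ 2 f) (hfc : HasCompactSupport f) :
    ∃ B, ∀ r, 0 < r → |circlePairing v r f| ≤ B := by
  obtain ⟨C, hC⟩ := hf.exists_norm_fderiv_fderiv_le hfc
  refine ⟨2 / Real.pi * ∫ ζ, (v ζ).toReal * C, fun r hr => ?_⟩
  have hpi := Real.pi_pos
  rw [circlePairing, abs_mul, abs_neg, abs_of_pos (show 0 < 2 / Real.pi by positivity)]
  gcongr
  rw [← Real.norm_eq_abs]
  refine (norm_integral_le_integral_norm _).trans ?_
  refine integral_mono_of_nonneg (ae_of_all _ fun _ => norm_nonneg _)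
    ((hv.integrable_toReal hfin).mul_const C) (ae_of_all _ fun ζ => ?_)
  simp only [norm_mul, Real.norm_eq_abs, ENNReal.abs_toReal]
  gcongr
  exact hf.abs_circleAverage_sub_div_le hC ζ hr

theorem tendsto_circlePairing (hv : IsNonnegSuperharmonicOn v U) (hfin : ∫⁻ ζ, v ζ ≠ ⊤)
    {f : ℂ → ℝ} (hf : ContDiff ℝ 2 f) (hfc : HasCompactSupport f) :
    Tendsto (fun r => circlePairing v r f) (𝓝[>] 0)
      (𝓝 (-(2 * Real.pi)⁻¹ * ∫ ζ, (v ζ).toReal * Laplacian.laplacian f ζ)) := by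
  obtain ⟨C, hC⟩ := hf.exists_norm_fderiv_fderiv_le hfc
  have hlim : Tendsto (fun r => ∫ ζ, (v ζ).toReal * ((Real.circleAverage f ζ r - f ζ) / r ^ 2))
      (𝓝[>] 0) (𝓝 (∫ ζ, (v ζ).toReal * (Laplacian.laplacian f ζ / 4))) := by
    refine tendsto_integral_filter_of_dominated_convergence (fun ζ => (v ζ).toReal * C) ?_ ?_
      ((hv.integrable_toReal hfin).mul_const C) ?_
    · exact Eventually.of_forall fun r =>
        (hv.integrable_circlePairing hfin hf.continuous hfc r).aestronglyMeasurable
    · filter_upwards [self_mem_nhdsWithin] with r hr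
      refine ae_of_all _ fun ζ => ?_
      simp only [norm_mul, Real.norm_eq_abs, ENNReal.abs_toReal]
      gcongr
      exact hf.abs_circleAverage_sub_div_le hC ζ hr
    · exact ae_of_all _ fun ζ => (hf.tendsto_circleAverage_sub_div hC ζ).const_mul _
  have hpi := Real.pi_pos
  have heq : -(2 * Real.pi)⁻¹ * ∫ ζ, (v ζ).toReal * Laplacian.laplacian f ζ =
      -(2 / Real.pi) * ∫ ζ, (v ζ).toReal * (Laplacian.laplacian f ζ / 4) := by
    simp only [mul_div_assoc']
    rw [integral_div]
    field_simp
    ring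
  rw [heq]
  exact hlim.const_mul _

end IsNonnegSuperharmonicOn

/-! ### The distributional Laplacian as a measure -/

theorem tendsto_limUnder_of_eventually_abs_le {α : Type*} (F : Ultrafilter α) {a : α → ℝ} {b : ℝ}
    (h : ∀ᶠ n in (F : Filter α), |a n| ≤ b) : Tendsto a F (𝓝 (limUnder (F : Filter α) a)) := by
  refine tendsto_nhds_limUnder ?_
  have hle : ((F.map a : Ultrafilter ℝ) : Filter ℝ) ≤ 𝓟 (Icc (-b) b) := by
    rw [le_principal_iff]
    exact h.mono fun n hn => abs_le.1 hn
  obtain ⟨x, -, hx⟩ := isCompact_Icc.ultrafilter_le_nhds _ hle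
  exact ⟨x, hx⟩

/-- The distributional Laplacian of a nonnegative superharmonic function is minus a measure: a
positive functional is obtained as an ultrafilter limit of the difference quotients
`circlePairing v r`, localized by the cutoff `χ`, and represented by the Riesz–Markov–Kakutani
theorem. -/
theorem IsNonnegSuperharmonicOn.exists_measure_eq_laplacian {v : ℂ → ENNReal} {U : Set ℂ}
    (hv : IsNonnegSuperharmonicOn v U) (hfin : ∫⁻ ζ, v ζ ≠ ⊤) (hU : IsOpen U) {χ : ℂ → ℝ}
    (hχ : ContDiff ℝ 2 χ) (hχc : HasCompactSupport χ) (hχU : tsupport χ ⊆ U)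
    (hχ0 : ∀ z, 0 ≤ χ z) :
    ∃ μ : Measure ℂ, IsFiniteMeasureOnCompacts μ ∧ ∀ f : ℂ → ℝ, ContDiff ℝ 2 f →
      HasCompactSupport f → (∀ z, χ z * f z = f z) →
      ∫ ζ, f ζ ∂μ = -(2 * Real.pi)⁻¹ * ∫ ζ, (v ζ).toReal * Laplacian.laplacian f ζ := by
  obtain ⟨r₀, hr₀, hr₀U⟩ := hχc.isCompact.exists_cthickening_subset_open hU hχU
  have hball : ∀ r, r ≤ r₀ → ∀ z, χ z ≠ 0 → closedBall z r ⊆ U := fun r hr z hz =>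
    ((closedBall_subset_closedBall hr).trans
      (closedBall_subset_cthickening (subset_tsupport _ hz) r₀)).trans hr₀U
  obtain ⟨B, hB⟩ := hv.exists_abs_circlePairing_le hfin hχ hχc
  set r : ℕ → ℝ := fun n => 1 / ((n : ℝ) + 1) with hrdef
  have hrpos : ∀ n, 0 < r n := fun n => Nat.one_div_pos_of_nat
  have hrlim : Tendsto r atTop (𝓝[>] 0) := tendsto_nhdsWithin_iff.2
    ⟨tendsto_one_div_add_atTop_nhds_zero_nat, Eventually.of_forall hrpos⟩
  have hrlimF : Tendsto r (hyperfilter ℕ : Filter ℕ) (𝓝[>] 0) :=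
    hrlim.mono_left Nat.hyperfilter_le_atTop
  have hsmall : ∀ᶠ n in (hyperfilter ℕ : Filter ℕ), r n ≤ r₀ :=
    (hrlimF.mono_right nhdsWithin_le_nhds).eventually (eventually_le_nhds hr₀)
  have hcont : ∀ f : C_c(ℂ, ℝ), Continuous fun z => χ z * f z := fun f =>
    hχ.continuous.mul f.continuous
  have hcomp : ∀ f : ℂ → ℝ, HasCompactSupport fun z => χ z * f z := fun f => hχc.mul_right
  -- Comparison with `c χ` for `c = sup |f|` bounds the functionals uniformly.
  have hbdd : ∀ f : C_c(ℂ, ℝ), ∃ b, ∀ᶠ n in (hyperfilter ℕ : Filter ℕ),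
      |circlePairing v (r n) (fun z => χ z * f z)| ≤ b := by
    intro f
    obtain ⟨c, hc⟩ := f.continuous.bounded_above_of_compact_support f.hasCompactSupport
    refine ⟨|c| * B, hsmall.mono fun n hn => ?_⟩
    -- `|c| χ + σ χ f ≥ 0` for `σ = ±1`.
    have hpos : ∀ σ : ℝ, |σ| = 1 → 0 ≤ |c| * circlePairing v (r n) χ +
        σ * circlePairing v (r n) (fun z => χ z * f z) := by
      intro σ hσ
      rw [← circlePairing_const_mul, ← circlePairing_const_mul,
        ← hv.circlePairing_add (g := fun z => |c| * χ z) (h := fun z => σ * (χ z * f z)) hfin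
          (continuous_const.mul hχ.continuous) hχc.mul_left
          (continuous_const.mul (hcont f)) (hcomp f).mul_left]
      refine hv.circlePairing_nonneg (g := fun z => |c| * χ z + σ * (χ z * f z)) hfin
        ((continuous_const.mul hχ.continuous).add
        (continuous_const.mul (hcont f))) (hχc.mul_left.add (hcomp f).mul_left) (fun z => ?_)
        (hrpos n) (fun z hz => hball _ hn z ?_)
      · have h1 : |σ * f z| ≤ |c| := by
          rw [abs_mul, hσ, one_mul]
          exact (hc z).trans (le_abs_self c)
        have h2 := (abs_le.1 h1).1
        have : |c| * χ z + σ * (χ z * f z) = χ z * (|c| + σ * f z) := by ring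
        rw [this]
        exact mul_nonneg (hχ0 z) (by linarith)
      · rintro h
        simp [h] at hz
    have h1 := hpos 1 (by simp)
    have h2 := hpos (-1) (by simp)
    have h3 : |c| * circlePairing v (r n) χ ≤ |c| * B :=
      mul_le_mul_of_nonneg_left ((le_abs_self _).trans (hB _ (hrpos n))) (abs_nonneg c)
    rw [abs_le]
    constructor <;> linarith
  have hlim : ∀ f : C_c(ℂ, ℝ), Tendsto (fun n => circlePairing v (r n) (fun z => χ z * f z))
      (hyperfilter ℕ : Filter ℕ) (𝓝 (limUnder (hyperfilter ℕ : Filter ℕ)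
        fun n => circlePairing v (r n) (fun z => χ z * f z))) := fun f =>
    tendsto_limUnder_of_eventually_abs_le _ (hbdd f).choose_spec
  let L : C_c(ℂ, ℝ) →ₗ[ℝ] ℝ :=
    { toFun := fun f => limUnder (hyperfilter ℕ : Filter ℕ)
        fun n => circlePairing v (r n) (fun z => χ z * f z)
      map_add' := fun f g => by
        refine tendsto_nhds_unique (hlim (f + g)) (((hlim f).add (hlim g)).congr fun n => ?_)
        rw [← hv.circlePairing_add hfin (hcont f) (hcomp f) (hcont g) (hcomp g)]
        congr 1
        funext z
        simp [mul_add]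
      map_smul' := fun c f => by
        refine tendsto_nhds_unique (hlim (c • f)) (((hlim f).const_mul c).congr fun n => ?_)
        rw [← circlePairing_const_mul]
        congr 1
        funext z
        simp only [CompactlySupportedContinuousMap.smul_apply, smul_eq_mul]
        ring }
  have hLpos : ∀ f : C_c(ℂ, ℝ), 0 ≤ f → 0 ≤ L f := fun f hf =>
    ge_of_tendsto (hlim f) <| hsmall.mono fun n hn =>
      hv.circlePairing_nonneg hfin (hcont f) (hcomp f) (fun z => mul_nonneg (hχ0 z) (hf z))
        (hrpos n) fun z hz => hball _ hn z (left_ne_zero_of_mul hz)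
  refine ⟨RealRMK.rieszMeasure (PositiveLinearMap.mk₀ L hLpos), inferInstance,
    fun f hf hfc hχf => ?_⟩
  have h1 := RealRMK.integral_rieszMeasure (PositiveLinearMap.mk₀ L hLpos)
    ⟨⟨f, hf.continuous⟩, hfc⟩
  refine h1.trans (tendsto_nhds_unique (hlim ⟨⟨f, hf.continuous⟩, hfc⟩) ?_)
  have h2 := (hv.tendsto_circlePairing hfin hf hfc).comp hrlimF
  refine h2.congr fun n => ?_
  simp only [Function.comp, CompactlySupportedContinuousMap.coe_mk, ContinuousMap.coe_mk, hχf]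

/-! ### Regularized logarithms and the cutoff kernel -/

theorem fderiv_fderiv_apply_apply {f : ℂ → ℝ} (hf : ContDiff ℝ 2 f) (z e : ℂ) :
    fderiv ℝ (fderiv ℝ f) z e e = fderiv ℝ (fun ζ => fderiv ℝ f ζ e) z e := by
  have h := ((ContinuousLinearMap.apply ℝ ℝ e).hasFDerivAt).comp z (hf.hasFDerivAt_fderiv z)
  have h' : HasFDerivAt (fun ζ => fderiv ℝ f ζ e)
    ((ContinuousLinearMap.apply ℝ ℝ e).comp (fderiv ℝ (fderiv ℝ f) z)) z := h
  rw [h'.fderiv]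
  rfl

theorem fderiv_fderiv_mul_apply_apply {f g : ℂ → ℝ} (hf : ContDiff ℝ 2 f) (hg : ContDiff ℝ 2 g)
    (z e : ℂ) : fderiv ℝ (fderiv ℝ fun ζ => f ζ * g ζ) z e e =
      f z * fderiv ℝ (fderiv ℝ g) z e e + 2 * (fderiv ℝ f z e * fderiv ℝ g z e) +
        g z * fderiv ℝ (fderiv ℝ f) z e e := by
  have hf1 : ∀ ζ, HasFDerivAt f (fderiv ℝ f ζ) ζ := fun ζ =>
    (hf.differentiable two_ne_zero ζ).hasFDerivAt
  have hg1 : ∀ ζ, HasFDerivAt g (fderiv ℝ g ζ) ζ := fun ζ =>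
    (hg.differentiable two_ne_zero ζ).hasFDerivAt
  have hf2 : HasFDerivAt (fun ζ => fderiv ℝ f ζ e) _ z :=
    ((ContinuousLinearMap.apply ℝ ℝ e).hasFDerivAt).comp z (hf.hasFDerivAt_fderiv z)
  have hg2 : HasFDerivAt (fun ζ => fderiv ℝ g ζ e) _ z :=
    ((ContinuousLinearMap.apply ℝ ℝ e).hasFDerivAt).comp z (hg.hasFDerivAt_fderiv z)
  rw [fderiv_fderiv_apply_apply (hf.mul hg)]
  have h1 : (fun ζ => fderiv ℝ (fun ζ => f ζ * g ζ) ζ e) =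
      fun ζ => f ζ * fderiv ℝ g ζ e + g ζ * fderiv ℝ f ζ e := by
    funext ζ
    rw [((hf1 ζ).fun_mul (hg1 ζ)).fderiv]
    simp
  rw [h1, (((hf1 z).fun_mul hg2).fun_add ((hg1 z).fun_mul hf2)).fderiv]
  simp
  ring

theorem laplacian_mul {f g : ℂ → ℝ} (hf : ContDiff ℝ 2 f) (hg : ContDiff ℝ 2 g) (z : ℂ) :
    Laplacian.laplacian (fun ζ => f ζ * g ζ) z = f z * Laplacian.laplacian g z +
      2 * (fderiv ℝ f z 1 * fderiv ℝ g z 1 +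
        fderiv ℝ f z Complex.I * fderiv ℝ g z Complex.I) + g z * Laplacian.laplacian f z := by
  simp only [laplacian_eq_fderiv_fderiv, fderiv_fderiv_mul_apply_apply hf hg]
  ring

/-- The smooth approximation `½ log (|ζ - z|² + s²)` of `log |ζ - z|`, decreasing to it as
`s` decreases to `0`. -/
noncomputable def smoothLog (s : ℝ) (z ζ : ℂ) : ℝ := 2⁻¹ * Real.log (‖ζ - z‖ ^ 2 + s ^ 2)

/-- The Laplacian of `smoothLog`, divided by `2π`: a radial approximate identity. -/
noncomputable def radialKernel (s ρ : ℝ) : ℝ := s ^ 2 / (Real.pi * (ρ ^ 2 + s ^ 2) ^ 2)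

theorem radialKernel_nonneg (s ρ : ℝ) : 0 ≤ radialKernel s ρ := by
  have := Real.pi_pos
  unfold radialKernel
  positivity

theorem continuous_radialKernel {s : ℝ} (hs : 0 < s) : Continuous (radialKernel s) := by
  have := Real.pi_pos
  unfold radialKernel
  refine Continuous.div (by fun_prop) (by fun_prop) fun ρ => by positivity

theorem hasFDerivAt_norm_sub_sq_add (z ζ : ℂ) (s : ℝ) :
    HasFDerivAt (fun ζ : ℂ => ‖ζ - z‖ ^ 2 + s ^ 2) (2 • innerSL ℝ (ζ - z)) ζ := by
  have := ((hasFDerivAt_id ζ).sub_const z).norm_sq.add_const (s ^ 2)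
  simpa using this

theorem contDiff_smoothLog {s : ℝ} (hs : 0 < s) (z : ℂ) : ContDiff ℝ 2 (smoothLog s z) := by
  unfold smoothLog
  refine contDiff_const.mul (ContDiff.log ?_ fun ζ => by positivity)
  exact ((contDiff_id.sub contDiff_const).norm_sq ℝ).add contDiff_const

theorem fderiv_smoothLog_apply {s : ℝ} (hs : 0 < s) (z ζ e : ℂ) :
    fderiv ℝ (smoothLog s z) ζ e = inner ℝ (ζ - z) e / (‖ζ - z‖ ^ 2 + s ^ 2) := by
  have h : HasFDerivAt (smoothLog s z) _ ζ :=
    ((hasFDerivAt_norm_sub_sq_add z ζ s).log (by positivity)).const_mul 2⁻¹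
  rw [h.fderiv]
  simp
  ring

theorem fderiv_fderiv_smoothLog_apply {s : ℝ} (hs : 0 < s) (z ζ e : ℂ) :
    fderiv ℝ (fderiv ℝ (smoothLog s z)) ζ e e =
      (‖e‖ ^ 2 * (‖ζ - z‖ ^ 2 + s ^ 2) - 2 * inner ℝ (ζ - z) e ^ 2) /
        (‖ζ - z‖ ^ 2 + s ^ 2) ^ 2 := by
  have hq : ‖ζ - z‖ ^ 2 + s ^ 2 ≠ 0 := by positivity
  rw [fderiv_fderiv_apply_apply (contDiff_smoothLog hs z)]
  simp only [fderiv_smoothLog_apply hs]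
  have h1 : HasFDerivAt (fun ζ : ℂ => inner ℝ (ζ - z) e) (innerSL ℝ e) ζ := by
    have := ((innerSL ℝ e).hasFDerivAt (x := ζ - z)).comp ζ ((hasFDerivAt_id ζ).sub_const z)
    refine (this.congr_fderiv (by ext; simp)).congr_of_eventuallyEq ?_
    exact Eventually.of_forall fun w => by simp [real_inner_comm]
  have h2 := hasFDerivAt_norm_sub_sq_add z ζ s
  have h3 := h1.mul ((hasDerivAt_inv hq).comp_hasFDerivAt ζ h2)
  rw [show (fun ζ : ℂ => inner ℝ (ζ - z) e / (‖ζ - z‖ ^ 2 + s ^ 2)) =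
    (fun ζ : ℂ => inner ℝ (ζ - z) e) * (Inv.inv ∘ fun ζ => ‖ζ - z‖ ^ 2 + s ^ 2) from rfl, h3.fderiv]
  simp only [_root_.add_apply, _root_.smul_apply, innerSL_apply_apply, smul_eq_mul,
    Function.comp, real_inner_self_eq_norm_sq, nsmul_eq_mul]
  field_simp
  push_cast
  ring

theorem laplacian_smoothLog {s : ℝ} (hs : 0 < s) (z ζ : ℂ) :
    Laplacian.laplacian (smoothLog s z) ζ = 2 * Real.pi * radialKernel s ‖ζ - z‖ := by
  have hpi := Real.pi_pos
  have hq : ‖ζ - z‖ ^ 2 + s ^ 2 ≠ 0 := by positivity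
  rw [laplacian_eq_fderiv_fderiv, fderiv_fderiv_smoothLog_apply hs,
    fderiv_fderiv_smoothLog_apply hs, radialKernel]
  have h : ‖ζ - z‖ ^ 2 = (ζ - z).re ^ 2 + (ζ - z).im ^ 2 := by
    rw [Complex.sq_norm, Complex.normSq_apply]; ring
  have h1 : inner ℝ (ζ - z) 1 = (ζ - z).re := by simp [Complex.inner]
  have h2 : inner ℝ (ζ - z) Complex.I = (ζ - z).im := by
    simp [Complex.inner]; ring
  rw [h1, h2, Complex.norm_I, norm_one]
  field_simp
  rw [h]
  ring

/-- The terms in `Δ(χ · smoothLog s z) / 2π` that contain derivatives of the cutoff `χ`. For `s = 0`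
this is the corresponding expression for `χ(ζ) log |ζ - z|`. -/
noncomputable def cutoffKernel (χ : ℂ → ℝ) (s : ℝ) (z ζ : ℂ) : ℝ :=
  (2 * Real.pi)⁻¹ * (2 * ((fderiv ℝ χ ζ 1 * (ζ - z).re + fderiv ℝ χ ζ Complex.I * (ζ - z).im) /
    (‖ζ - z‖ ^ 2 + s ^ 2)) + smoothLog s z ζ * Laplacian.laplacian χ ζ)

theorem laplacian_mul_smoothLog {χ : ℂ → ℝ} (hχ : ContDiff ℝ 2 χ) {s : ℝ} (hs : 0 < s) (z ζ : ℂ) :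
    Laplacian.laplacian (fun ζ => χ ζ * smoothLog s z ζ) ζ =
      2 * Real.pi * (χ ζ * radialKernel s ‖ζ - z‖ + cutoffKernel χ s z ζ) := by
  have hpi := Real.pi_pos
  rw [laplacian_mul hχ (contDiff_smoothLog hs z), laplacian_smoothLog hs,
    fderiv_smoothLog_apply hs, fderiv_smoothLog_apply hs, cutoffKernel]
  have h1 : inner ℝ (ζ - z) 1 = (ζ - z).re := by simp [Complex.inner]
  have h2 : inner ℝ (ζ - z) Complex.I = (ζ - z).im := by
    simp [Complex.inner]; ring
  rw [h1, h2]
  field_simp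
  ring

/-! ### The radial approximate identity -/

theorem lintegral_ball_radial {w : ℝ → ENNReal} (hw : Measurable w) (z : ℂ) (η : ℝ) :
    ∫⁻ ζ in ball z η, w ‖ζ - z‖ =
      ∫⁻ r in Ioo 0 η, ENNReal.ofReal r * (ENNReal.ofReal (2 * Real.pi) * w r) := by
  have hn : Measurable (fun ζ : ℂ => w ‖ζ - z‖) := by fun_prop
  rw [← lintegral_indicator measurableSet_ball,
    lintegral_eq_lintegral_circleMap (hn.indicator measurableSet_ball) z,
    ← Ioi_inter_Iio, inter_comm, ← setLIntegral_indicator measurableSet_Iio]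
  refine setLIntegral_congr_fun measurableSet_Ioi fun r hr => ?_
  have hr : 0 < r := hr
  have hnorm : ∀ θ : ℝ, ‖circleMap z r θ - z‖ = r := fun θ => by
    simp [circleMap, abs_of_pos hr]
  by_cases hrR : r < η
  · have hmem : ∀ θ : ℝ, circleMap z r θ ∈ ball z η := fun θ => by
      rw [mem_ball_iff_norm, hnorm]; exact hrR
    simp only [indicator_of_mem (hmem _), hnorm, indicator_of_mem (show r ∈ Iio η from hrR)]
    rw [lintegral_const, Measure.restrict_apply_univ, Real.volume_Ioc, sub_zero]
    ring
  · have hmem : ∀ θ : ℝ, circleMap z r θ ∉ ball z η := fun θ => by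
      rw [mem_ball_iff_norm, hnorm]; exact hrR
    simp [indicator_of_notMem (hmem _), indicator_of_notMem (show r ∉ Iio η from hrR)]

theorem lintegral_ball_radialKernel {s : ℝ} (hs : 0 < s) (z : ℂ) {η : ℝ} (hη : 0 < η) :
    ∫⁻ ζ in ball z η, ENNReal.ofReal (radialKernel s ‖ζ - z‖) =
      ENNReal.ofReal (1 - s ^ 2 / (η ^ 2 + s ^ 2)) := by
  have hpi := Real.pi_pos
  rw [lintegral_ball_radial (w := fun r => ENNReal.ofReal (radialKernel s r))
    (ENNReal.measurable_ofReal.comp (continuous_radialKernel hs).measurable)]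
  have hd : ∀ r : ℝ, HasDerivAt (fun r : ℝ => -(s ^ 2 / (r ^ 2 + s ^ 2)))
      (r * (2 * Real.pi * radialKernel s r)) r := fun r => by
    have hq : r ^ 2 + s ^ 2 ≠ 0 := by positivity
    have := ((((hasDerivAt_id r).pow 2).add_const (s ^ 2)).fun_inv hq).const_mul (-(s ^ 2))
    refine (this.congr_deriv ?_).congr_of_eventuallyEq (Eventually.of_forall fun x => ?_)
    · simp only [radialKernel, id]
      simp only [Pi.pow_apply, id]
      field_simp
      norm_num
      ring
    · simp [div_eq_mul_inv]
  have hc : Continuous fun r => r * (2 * Real.pi * radialKernel s r) :=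
    continuous_id.mul (continuous_const.mul (continuous_radialKernel hs))
  have h1 : ∫⁻ r in Ioo 0 η, ENNReal.ofReal r * (ENNReal.ofReal (2 * Real.pi) *
      ENNReal.ofReal (radialKernel s r)) =
      ∫⁻ r in Ioo 0 η, ENNReal.ofReal (r * (2 * Real.pi * radialKernel s r)) := by
    refine setLIntegral_congr_fun measurableSet_Ioo fun r hr => ?_
    rw [← ENNReal.ofReal_mul (by positivity), ← ENNReal.ofReal_mul hr.1.le]
  rw [h1, setLIntegral_congr Ioo_ae_eq_Ioc, ← ofReal_integral_eq_lintegral_ofReal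
    hc.integrableOn_Ioc, ← intervalIntegral.integral_of_le hη.le,
    intervalIntegral.integral_eq_sub_of_hasDerivAt (fun r _ => hd r) (hc.intervalIntegrable _ _)]
  · congr 1
    have : s ^ 2 ≠ 0 := by positivity
    field_simp
    ring
  · filter_upwards [ae_restrict_mem measurableSet_Ioc] with r hr
    exact mul_nonneg hr.1.le (mul_nonneg (by positivity) (radialKernel_nonneg s r))

/-! ### Passage to the limit in the regularization -/

/-- Averaging a nonnegative superharmonic function against `radialKernel s` recovers its value at
the centre: the super-mean value property bounds the limit from above, and lower semicontinuity
from below. -/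
theorem IsNonnegSuperharmonicOn.tendsto_lintegral_radialKernel {v : ℂ → ENNReal} {U : Set ℂ}
    (hv : IsNonnegSuperharmonicOn v U) (hfin : ∫⁻ ζ, v ζ ≠ ⊤) {z : ℂ} (hz : U ∈ 𝓝 z) {χ : ℂ → ℝ}
    (hχ1 : ∀ ζ, χ ζ ≤ 1) (hχz : ∀ᶠ ζ in 𝓝 z, χ ζ = 1) :
    Tendsto (fun s => ∫⁻ ζ, v ζ * ENNReal.ofReal (χ ζ * radialKernel s ‖ζ - z‖)) (𝓝[>] 0)
      (𝓝 (v z)) := by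
  have hpi := Real.pi_pos
  obtain ⟨R, hR, hRU⟩ := Metric.mem_nhds_iff.1 hz
  rw [tendsto_order]
  constructor
  · intro a ha
    obtain ⟨b, hab, hbv⟩ := exists_between ha
    obtain ⟨η, hη, hηb⟩ := Metric.mem_nhds_iff.1 ((hv.lsc z b hbv).and hχz)
    have hlow : ∀ s : ℝ, 0 < s → b * ENNReal.ofReal (1 - s ^ 2 / (η ^ 2 + s ^ 2)) ≤
        ∫⁻ ζ, v ζ * ENNReal.ofReal (χ ζ * radialKernel s ‖ζ - z‖) := fun s hs => by
      rw [← lintegral_ball_radialKernel hs z hη, ← lintegral_const_mul]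
      · refine le_trans ?_ (setLIntegral_le_lintegral (ball z η) _)
        refine setLIntegral_mono' measurableSet_ball fun ζ hζ => ?_
        have h := hηb hζ
        rw [h.2, one_mul]
        exact mul_le_mul_left h.1.le _
      · exact ENNReal.measurable_ofReal.comp
          ((continuous_radialKernel hs).measurable.comp (by fun_prop))
    have hlim : Tendsto (fun s : ℝ => b * ENNReal.ofReal (1 - s ^ 2 / (η ^ 2 + s ^ 2))) (𝓝[>] 0)
        (𝓝 (b * ENNReal.ofReal (1 - 0 ^ 2 / (η ^ 2 + 0 ^ 2)))) := by
      refine ENNReal.Tendsto.const_mul (ENNReal.tendsto_ofReal ?_) (.inr hbv.ne_top)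
      refine (ContinuousAt.tendsto ?_).mono_left nhdsWithin_le_nhds
      have : η ^ 2 + (0 : ℝ) ^ 2 ≠ 0 := by positivity
      fun_prop (disch := exact this)
    have hb : b * ENNReal.ofReal (1 - 0 ^ 2 / (η ^ 2 + 0 ^ 2)) = b := by simp
    rw [hb] at hlim
    filter_upwards [hlim.eventually (lt_mem_nhds hab), self_mem_nhdsWithin] with s hs hs0
    exact hs.trans_le (hlow s hs0)
  · intro b hb
    have hup : ∀ s : ℝ, 0 < s → ∫⁻ ζ, v ζ * ENNReal.ofReal (χ ζ * radialKernel s ‖ζ - z‖) ≤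
        v z + ENNReal.ofReal (s ^ 2 / (Real.pi * R ^ 4)) * ∫⁻ ζ, v ζ := fun s hs => by
      have hwm : Measurable fun r => ENNReal.ofReal (radialKernel s r) :=
        ENNReal.measurable_ofReal.comp (continuous_radialKernel hs).measurable
      have hχle : ∀ ζ, χ ζ * radialKernel s ‖ζ - z‖ ≤ radialKernel s ‖ζ - z‖ := fun ζ =>
        mul_le_of_le_one_left (radialKernel_nonneg _ _) (hχ1 ζ)
      rw [← lintegral_add_compl _ (measurableSet_ball (x := z) (ε := R))]
      refine add_le_add ?_ ?_
      · calc ∫⁻ ζ in ball z R, v ζ * ENNReal.ofReal (χ ζ * radialKernel s ‖ζ - z‖)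
            ≤ ∫⁻ ζ in ball z R, ENNReal.ofReal (radialKernel s ‖ζ - z‖) * v ζ := by
              refine lintegral_mono fun ζ => ?_
              rw [mul_comm]
              exact mul_le_mul_left (ENNReal.ofReal_le_ofReal (hχle ζ)) _
          _ ≤ v z * ENNReal.ofReal (1 - s ^ 2 / (R ^ 2 + s ^ 2)) := by
              rw [← lintegral_ball_radialKernel hs z hR]
              exact hv.lintegral_radial_le hRU hwm
          _ ≤ v z * 1 := by
              gcongr
              rw [ENNReal.ofReal_le_one]
              have : 0 ≤ s ^ 2 / (R ^ 2 + s ^ 2) := by positivity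
              linarith
          _ = v z := mul_one _
      · calc ∫⁻ ζ in (ball z R)ᶜ, v ζ * ENNReal.ofReal (χ ζ * radialKernel s ‖ζ - z‖)
            ≤ ∫⁻ ζ in (ball z R)ᶜ, ENNReal.ofReal (s ^ 2 / (Real.pi * R ^ 4)) * v ζ := by
              refine setLIntegral_mono' measurableSet_ball.compl fun ζ hζ => ?_
              rw [mul_comm]
              refine mul_le_mul_left (ENNReal.ofReal_le_ofReal ((hχle ζ).trans ?_)) _
              have hζR : R ≤ ‖ζ - z‖ := not_lt.1 fun h => hζ (mem_ball_iff_norm.2 h)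
              unfold radialKernel
              have : R ^ 4 = (R ^ 2) ^ 2 := by ring
              rw [this]
              gcongr
              nlinarith [sq_nonneg s]
          _ ≤ ∫⁻ ζ, ENNReal.ofReal (s ^ 2 / (Real.pi * R ^ 4)) * v ζ :=
              setLIntegral_le_lintegral _ _
          _ = _ := lintegral_const_mul _ hv.measurable
    have hlim : Tendsto (fun s : ℝ => v z + ENNReal.ofReal (s ^ 2 / (Real.pi * R ^ 4)) *
        ∫⁻ ζ, v ζ) (𝓝[>] 0) (𝓝 (v z + ENNReal.ofReal (0 ^ 2 / (Real.pi * R ^ 4)) *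
        ∫⁻ ζ, v ζ)) := by
      refine tendsto_const_nhds.add (ENNReal.Tendsto.mul_const (ENNReal.tendsto_ofReal ?_)
        (.inr hfin))
      exact (Continuous.tendsto (by fun_prop) _).mono_left nhdsWithin_le_nhds
    simp only [ne_eq, OfNat.ofNat_ne_zero, not_false_eq_true, zero_pow, zero_div,
      ENNReal.ofReal_zero, zero_mul, add_zero] at hlim
    filter_upwards [hlim.eventually (gt_mem_nhds hb), self_mem_nhdsWithin] with s hs hs0
    exact (hup s hs0).trans_lt hs

/-- Cutoff functions equal to `1` near the closed disk of radius `3` and supported well inside the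
disk of radius `4`. -/
structure IsCutoff (χ : ℂ → ℝ) : Prop where
  contDiff : ContDiff ℝ 2 χ
  nonneg : ∀ z, 0 ≤ χ z
  le_one : ∀ z, χ z ≤ 1
  eq_one : ∀ z ∈ ball (0 : ℂ) (13 / 4), χ z = 1
  tsupport_subset : tsupport χ ⊆ closedBall 0 (7 / 2)

theorem exists_isCutoff : ∃ χ : ℂ → ℝ, IsCutoff χ := by
  let f : ContDiffBump (0 : ℂ) := ⟨13 / 4, 7 / 2, by norm_num, by norm_num⟩
  exact ⟨f, f.contDiff, fun _ => f.nonneg, fun _ => f.le_one,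
    fun z hz => f.one_of_mem_closedBall (ball_subset_closedBall hz), f.tsupport_eq.le⟩

namespace IsCutoff

variable {χ : ℂ → ℝ}

theorem hasCompactSupport (hχ : IsCutoff χ) : HasCompactSupport χ :=
  (isCompact_closedBall (0 : ℂ) (7 / 2)).of_isClosed_subset (isClosed_tsupport χ) hχ.tsupport_subset

theorem eq_zero (hχ : IsCutoff χ) {ζ : ℂ} (hζ : ζ ∉ closedBall (0 : ℂ) (7 / 2)) : χ ζ = 0 :=
  image_eq_zero_of_notMem_tsupport fun h => hζ (hχ.tsupport_subset h)

theorem exists_locally_const (hχ : IsCutoff χ) {ζ : ℂ}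
    (hζ : ζ ∈ ball (0 : ℂ) (13 / 4) ∨ ζ ∉ closedBall (0 : ℂ) (7 / 2)) :
    ∃ c : ℝ, χ =ᶠ[𝓝 ζ] fun _ => c := by
  rcases hζ with h | h
  · exact ⟨1, by filter_upwards [isOpen_ball.mem_nhds h] with w hw using hχ.eq_one w hw⟩
  · refine ⟨0, ?_⟩
    filter_upwards [isClosed_closedBall.isOpen_compl.mem_nhds h] with w hw using hχ.eq_zero hw

theorem fderiv_eq_zero (hχ : IsCutoff χ) {ζ : ℂ}
    (hζ : ζ ∈ ball (0 : ℂ) (13 / 4) ∨ ζ ∉ closedBall (0 : ℂ) (7 / 2)) : fderiv ℝ χ ζ = 0 := by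
  obtain ⟨c, hc⟩ := hχ.exists_locally_const hζ
  rw [hc.fderiv_eq]
  simp

theorem laplacian_eq_zero (hχ : IsCutoff χ) {ζ : ℂ}
    (hζ : ζ ∈ ball (0 : ℂ) (13 / 4) ∨ ζ ∉ closedBall (0 : ℂ) (7 / 2)) :
    Laplacian.laplacian χ ζ = 0 := by
  obtain ⟨c, hc⟩ := hχ.exists_locally_const hζ
  rw [laplacian_eq_fderiv_fderiv, hc.fderiv.fderiv_eq]
  simp

theorem cutoffKernel_eq_zero (hχ : IsCutoff χ) {ζ : ℂ}
    (hζ : ζ ∈ ball (0 : ℂ) (13 / 4) ∨ ζ ∉ closedBall (0 : ℂ) (7 / 2)) (s : ℝ) (z : ℂ) :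
    cutoffKernel χ s z ζ = 0 := by
  simp [cutoffKernel, hχ.fderiv_eq_zero hζ, hχ.laplacian_eq_zero hζ]

end IsCutoff

theorem norm_sub_mem_Icc {z ζ : ℂ} (hz : z ∈ ball (0 : ℂ) 3)
    (h1 : ζ ∉ ball (0 : ℂ) (13 / 4)) (h2 : ζ ∈ closedBall (0 : ℂ) (7 / 2)) :
    ‖ζ - z‖ ∈ Icc (1 / 4 : ℝ) (13 / 2) := by
  simp only [mem_ball_zero_iff, mem_closedBall_zero_iff, not_lt] at hz h1 h2
  have := norm_sub_le ζ z
  have := norm_sub_norm_le ζ z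
  constructor <;> linarith

namespace IsCutoff

variable {χ : ℂ → ℝ}

/-- A bound for the first and second derivatives of a cutoff function. -/
theorem exists_derivative_bound (hχ : IsCutoff χ) :
    ∃ D, 0 ≤ D ∧ (∀ ζ, ‖fderiv ℝ χ ζ‖ ≤ D) ∧ ∀ ζ, |Laplacian.laplacian χ ζ| ≤ D := by
  obtain ⟨C, hC⟩ := hχ.contDiff.exists_norm_fderiv_fderiv_le hχ.hasCompactSupport
  have hc : HasCompactSupport (fderiv ℝ χ) := hχ.hasCompactSupport.fderiv ℝ
  have hcont : Continuous (fderiv ℝ χ) := hχ.contDiff.continuous_fderiv two_ne_zero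
  obtain ⟨C', hC'⟩ := Continuous.bounded_above_of_compact_support (f := fderiv ℝ χ) hcont hc
  have h0 : 0 ≤ C := (ContinuousLinearMap.opNorm_nonneg _).trans (hC 0)
  have h0' : 0 ≤ C' := (norm_nonneg _).trans (hC' 0)
  refine ⟨C' + 2 * C, by positivity, fun ζ => (hC' ζ).trans (by linarith), fun ζ => ?_⟩
  rw [laplacian_eq_fderiv_fderiv]
  have h1 := (fderiv ℝ (fderiv ℝ χ) ζ).le_opNorm₂ 1 1
  have h2 := (fderiv ℝ (fderiv ℝ χ) ζ).le_opNorm₂ Complex.I Complex.I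
  simp only [norm_one, Complex.norm_I, mul_one] at h1 h2
  rw [Real.norm_eq_abs] at h1 h2
  have h3 := abs_add_le (fderiv ℝ (fderiv ℝ χ) ζ 1 1)
    (fderiv ℝ (fderiv ℝ χ) ζ Complex.I Complex.I)
  have := hC ζ
  linarith

theorem exists_abs_cutoffKernel_le (hχ : IsCutoff χ) : ∃ C, 0 ≤ C ∧
    ∀ s ∈ Icc (0 : ℝ) 1, ∀ z ∈ ball (0 : ℂ) 3, ∀ ζ, |cutoffKernel χ s z ζ| ≤ C := by
  obtain ⟨D, hD0, hD1, hD2⟩ := hχ.exists_derivative_bound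
  have hpi := Real.pi_pos
  refine ⟨(2 * Real.pi)⁻¹ * (2 * ((D * (13 / 2) + D * (13 / 2)) / (1 / 16)) + 50 * D),
    by positivity, fun s hs z hz ζ => ?_⟩
  by_cases hζ : ζ ∈ ball (0 : ℂ) (13 / 4) ∨ ζ ∉ closedBall (0 : ℂ) (7 / 2)
  · rw [hχ.cutoffKernel_eq_zero hζ, abs_zero]
    positivity
  · push Not at hζ
    obtain ⟨hl, hu⟩ := norm_sub_mem_Icc hz hζ.1 hζ.2
    have hq1 : 1 / 16 ≤ ‖ζ - z‖ ^ 2 + s ^ 2 := by nlinarith [sq_nonneg s]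
    have hq2 : ‖ζ - z‖ ^ 2 + s ^ 2 ≤ 50 := by nlinarith [hs.1, hs.2]
    have hq0 : 0 < ‖ζ - z‖ ^ 2 + s ^ 2 := by linarith
    have hlog : |smoothLog s z ζ| ≤ 50 := by
      have h1 := Real.log_le_sub_one_of_pos hq0
      have h2 := Real.one_sub_inv_le_log_of_pos hq0
      have h3 : (‖ζ - z‖ ^ 2 + s ^ 2)⁻¹ ≤ 16 := by
        rw [inv_le_comm₀ hq0 (by norm_num)]
        linarith
      rw [smoothLog, abs_le]
      constructor <;> linarith
    have hre := (Complex.abs_re_le_norm (ζ - z)).trans hu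
    have him := (Complex.abs_im_le_norm (ζ - z)).trans hu
    have hd1 : |fderiv ℝ χ ζ 1| ≤ D := by
      have := (fderiv ℝ χ ζ).le_opNorm 1
      rw [norm_one, mul_one, Real.norm_eq_abs] at this
      exact this.trans (hD1 ζ)
    have hd2 : |fderiv ℝ χ ζ Complex.I| ≤ D := by
      have := (fderiv ℝ χ ζ).le_opNorm Complex.I
      rw [Complex.norm_I, mul_one, Real.norm_eq_abs] at this
      exact this.trans (hD1 ζ)
    rw [cutoffKernel, abs_mul, abs_of_pos (by positivity : 0 < (2 * Real.pi)⁻¹)]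
    gcongr
    refine (abs_add_le _ _).trans (add_le_add ?_ ?_)
    · rw [abs_mul, abs_two, abs_div, abs_of_pos hq0]
      gcongr
      refine (abs_add_le _ _).trans (add_le_add ?_ ?_)
      · rw [abs_mul]; gcongr
      · rw [abs_mul]; gcongr
    · rw [abs_mul]
      gcongr
      exact hD2 ζ

theorem measurable_cutoffKernel (hχ : IsCutoff χ) (s : ℝ) (z : ℂ) :
    Measurable (cutoffKernel χ s z) := by
  have h1 : Continuous (fderiv ℝ χ) := hχ.contDiff.continuous_fderiv two_ne_zero
  have h2 : Measurable fun ζ => fderiv ℝ χ ζ 1 := (h1.clm_apply continuous_const).measurable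
  have h3 : Measurable fun ζ => fderiv ℝ χ ζ Complex.I :=
    (h1.clm_apply continuous_const).measurable
  have h4 : Measurable (Laplacian.laplacian χ : ℂ → ℝ) :=
    hχ.contDiff.continuous_laplacian.measurable
  have h5 : Measurable (smoothLog s z) := by
    unfold smoothLog
    fun_prop
  unfold cutoffKernel
  fun_prop

theorem tendsto_cutoffKernel (hχ : IsCutoff χ) {z : ℂ} (hz : z ∈ ball (0 : ℂ) 3) (ζ : ℂ) :
    Tendsto (fun s => cutoffKernel χ s z ζ) (𝓝[>] 0) (𝓝 (cutoffKernel χ 0 z ζ)) := by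
  by_cases hζ : ζ ∈ ball (0 : ℂ) (13 / 4) ∨ ζ ∉ closedBall (0 : ℂ) (7 / 2)
  · simp only [hχ.cutoffKernel_eq_zero hζ]
    exact tendsto_const_nhds
  · push Not at hζ
    obtain ⟨hl, hu⟩ := norm_sub_mem_Icc hz hζ.1 hζ.2
    have hq : ‖ζ - z‖ ^ 2 + (0 : ℝ) ^ 2 ≠ 0 := by positivity
    refine (ContinuousAt.tendsto (f := fun s => cutoffKernel χ s z ζ) ?_).mono_left
      nhdsWithin_le_nhds
    unfold cutoffKernel smoothLog
    fun_prop (disch := exact hq)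

end IsCutoff

theorem IsNonnegSuperharmonicOn.tendsto_integral_cutoffKernel {v : ℂ → ENNReal} {U : Set ℂ}
    (hv : IsNonnegSuperharmonicOn v U) (hfin : ∫⁻ ζ, v ζ ≠ ⊤) {χ : ℂ → ℝ} (hχ : IsCutoff χ)
    {z : ℂ} (hz : z ∈ ball (0 : ℂ) 3) :
    Tendsto (fun s => ∫ ζ, (v ζ).toReal * cutoffKernel χ s z ζ) (𝓝[>] 0)
      (𝓝 (∫ ζ, (v ζ).toReal * cutoffKernel χ 0 z ζ)) := by
  obtain ⟨C, hC0, hC⟩ := hχ.exists_abs_cutoffKernel_le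
  refine tendsto_integral_filter_of_dominated_convergence (fun ζ => (v ζ).toReal * C) ?_ ?_
    ((hv.integrable_toReal hfin).mul_const C) ?_
  · exact Eventually.of_forall fun s => (hv.measurable.ennreal_toReal.mul
      (hχ.measurable_cutoffKernel s z)).aestronglyMeasurable
  · filter_upwards [Ioo_mem_nhdsGT zero_lt_one] with s hs
    refine ae_of_all _ fun ζ => ?_
    simp only [norm_mul, Real.norm_eq_abs, ENNReal.abs_toReal]
    gcongr
    exact hC s (Ioo_subset_Icc_self hs) z hz ζ
  · exact ae_of_all _ fun ζ => (hχ.tendsto_cutoffKernel hz ζ).const_mul _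

/-! ### Representation by the weighted potential -/

/-- The nonnegative function `25 - log |z - ζ|`, equal to `∞` at `ζ = z`. The constant `25` exceeds
the logarithm of every distance between points of the disk of radius `4`. -/
noncomputable def logDefect (z ζ : ℂ) : ENNReal :=
  (((25 : ℝ) : EReal) - ENNReal.log ‖z - ζ‖ₑ).toENNReal

theorem log_enorm_sub {z ζ : ℂ} (h : ζ ≠ z) :
    ENNReal.log ‖z - ζ‖ₑ = ((Real.log ‖ζ - z‖ : ℝ) : EReal) := by
  rw [← ofReal_norm, norm_sub_rev,
    ENNReal.log_ofReal_of_pos (norm_pos_iff.2 (sub_ne_zero.2 h))]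

theorem logDefect_of_ne {z ζ : ℂ} (h : ζ ≠ z) :
    logDefect z ζ = ENNReal.ofReal (25 - Real.log ‖ζ - z‖) := by
  rw [logDefect, log_enorm_sub h, ← EReal.coe_sub]
  rfl

theorem logDefect_self (z : ℂ) : logDefect z z = ⊤ := by
  simp [logDefect]

theorem smoothLog_mono {s t : ℝ} (hs : 0 < s) (hst : s ≤ t) (z ζ : ℂ) :
    smoothLog s z ζ ≤ smoothLog t z ζ := by
  unfold smoothLog
  have : 0 < ‖ζ - z‖ ^ 2 + s ^ 2 := by positivity
  gcongr

theorem smoothLog_le {s : ℝ} (hs : 0 < s) (hs1 : s ≤ 1) {z ζ : ℂ} (hz : z ∈ ball (0 : ℂ) 3)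
    (hζ : ζ ∈ closedBall (0 : ℂ) (7 / 2)) : smoothLog s z ζ ≤ 25 := by
  simp only [mem_ball_zero_iff, mem_closedBall_zero_iff] at hz hζ
  have h := norm_sub_le ζ z
  have hq : 0 < ‖ζ - z‖ ^ 2 + s ^ 2 := by positivity
  have := Real.log_le_sub_one_of_pos hq
  have : ‖ζ - z‖ ^ 2 + s ^ 2 ≤ 50 := by nlinarith [norm_nonneg (ζ - z)]
  unfold smoothLog
  linarith

theorem tendsto_ofReal_sub_smoothLog (z ζ : ℂ) :
    Tendsto (fun s => ENNReal.ofReal (25 - smoothLog s z ζ)) (𝓝[>] 0) (𝓝 (logDefect z ζ)) := by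
  by_cases h : ζ = z
  · subst h
    rw [logDefect_self]
    refine ENNReal.tendsto_ofReal_nhds_top.2 ?_
    have h1 : ∀ s, smoothLog s ζ ζ = Real.log s := fun s => by
      simp [smoothLog]
    simp only [h1]
    exact tendsto_atTop_add_const_left _ _
      (tendsto_neg_atBot_atTop.comp Real.tendsto_log_nhdsGT_zero)
  · rw [logDefect_of_ne h]
    have h0 : 0 < ‖ζ - z‖ := norm_pos_iff.2 (sub_ne_zero.2 h)
    have h1 : Real.log ‖ζ - z‖ = smoothLog 0 z ζ := by
      simp [smoothLog]
    rw [h1]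
    refine ENNReal.tendsto_ofReal (tendsto_const_nhds.sub ?_)
    refine (ContinuousAt.tendsto (f := fun s => smoothLog s z ζ) ?_).mono_left nhdsWithin_le_nhds
    have hq : ‖ζ - z‖ ^ 2 + (0 : ℝ) ^ 2 ≠ 0 := by positivity
    unfold smoothLog
    fun_prop (disch := exact hq)

/-- The distributional Laplacian of `v` is `-2π μ`, as far as test functions supported well inside
the disk of radius `4` can tell. The values of `v` enter through `ENNReal.toReal`, which is harmless
because an integrable `v` is finite almost everywhere. -/
def IsRieszMeasure (v : ℂ → ENNReal) (μ : Measure ℂ) : Prop :=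
  ∀ f : ℂ → ℝ, ContDiff ℝ 2 f → tsupport f ⊆ closedBall 0 (7 / 2) →
    ∫ ζ, f ζ ∂μ = -(2 * Real.pi)⁻¹ * ∫ ζ, (v ζ).toReal * Laplacian.laplacian f ζ

/-- The weighted potential of the Riesz measure, regularized at scale `s`. -/
theorem IsRieszMeasure.integral_mul_sub_smoothLog {v : ℂ → ENNReal} {U : Set ℂ} {μ : Measure ℂ}
    [IsFiniteMeasureOnCompacts μ] (hv : IsNonnegSuperharmonicOn v U) (hfin : ∫⁻ ζ, v ζ ≠ ⊤)
    (hμ : IsRieszMeasure v μ) {χ : ℂ → ℝ} (hχ : IsCutoff χ) {s : ℝ} (hs : s ∈ Ioc (0 : ℝ) 1)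
    {z : ℂ} (hz : z ∈ ball (0 : ℂ) 3) :
    ∫ ζ, χ ζ * (25 - smoothLog s z ζ) ∂μ = 25 * (∫ ζ, χ ζ ∂μ) +
      (∫ ζ, (v ζ).toReal * (χ ζ * radialKernel s ‖ζ - z‖)) +
      ∫ ζ, (v ζ).toReal * cutoffKernel χ s z ζ := by
  have hpi := Real.pi_pos
  obtain ⟨C, hC0, hC⟩ := hχ.exists_abs_cutoffKernel_le
  have hK := contDiff_smoothLog hs.1 z
  have hχi : Integrable χ μ := hχ.contDiff.continuous.integrable_of_hasCompactSupport
    hχ.hasCompactSupport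
  have hχKi : Integrable (fun ζ => χ ζ * smoothLog s z ζ) μ :=
    (hχ.contDiff.continuous.mul hK.continuous).integrable_of_hasCompactSupport
      hχ.hasCompactSupport.mul_right
  have hrk : Continuous fun ζ => χ ζ * radialKernel s ‖ζ - z‖ :=
    hχ.contDiff.continuous.mul ((continuous_radialKernel hs.1).comp (by fun_prop))
  obtain ⟨B, hB⟩ := hrk.bounded_above_of_compact_support hχ.hasCompactSupport.mul_right
  have h1 : ∫ ζ, χ ζ * (25 - smoothLog s z ζ) ∂μ =
      25 * (∫ ζ, χ ζ ∂μ) - ∫ ζ, χ ζ * smoothLog s z ζ ∂μ := by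
    rw [← integral_const_mul, ← integral_sub (hχi.const_mul 25) hχKi]
    congr 1
    funext ζ
    ring
  have h2 := hμ (fun ζ => χ ζ * smoothLog s z ζ) (hχ.contDiff.mul hK)
    ((tsupport_mul_subset_left).trans hχ.tsupport_subset)
  have h3 : ∫ ζ, (v ζ).toReal * Laplacian.laplacian (fun ζ => χ ζ * smoothLog s z ζ) ζ =
      2 * Real.pi * ((∫ ζ, (v ζ).toReal * (χ ζ * radialKernel s ‖ζ - z‖)) +
      ∫ ζ, (v ζ).toReal * cutoffKernel χ s z ζ) := by
    rw [← integral_add, ← integral_const_mul]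
    · congr 1
      funext ζ
      rw [laplacian_mul_smoothLog hχ.contDiff hs.1]
      ring
    · exact hv.integrable_toReal_mul hfin hrk.aestronglyMeasurable (fun ζ => by simpa using hB ζ)
    · exact hv.integrable_toReal_mul hfin (hχ.measurable_cutoffKernel s z).aestronglyMeasurable
        (hC s (Ioc_subset_Icc_self hs) z hz)
  rw [h1, h2, h3]
  field_simp
  ring

/-- The representation of `v` by the weighted potential of its Riesz measure. -/
theorem IsRieszMeasure.lintegral_mul_logDefect {v : ℂ → ENNReal} {μ : Measure ℂ}
    [IsFiniteMeasureOnCompacts μ] (hv : IsNonnegSuperharmonicOn v (ball 0 4))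
    (hfin : ∫⁻ ζ, v ζ ≠ ⊤) (hμ : IsRieszMeasure v μ) {χ : ℂ → ℝ} (hχ : IsCutoff χ)
    {z : ℂ} (hz : z ∈ ball (0 : ℂ) 3) :
    ((∫⁻ ζ, ENNReal.ofReal (χ ζ) * logDefect z ζ ∂μ : ENNReal) : EReal) =
      ((25 * (∫ ζ, χ ζ ∂μ) + ∫ ζ, (v ζ).toReal * cutoffKernel χ 0 z ζ : ℝ) : EReal) +
        (v z : EReal) := by
  set r : ℕ → ℝ := fun n => 1 / ((n : ℝ) + 1) with hrdef
  have hrpos : ∀ n, 0 < r n := fun n => Nat.one_div_pos_of_nat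
  have hr1 : ∀ n, r n ≤ 1 := fun n => by
    rw [hrdef]
    simp only
    rw [div_le_one (by positivity)]
    linarith [n.cast_nonneg (α := ℝ)]
  have hranti : Antitone r := fun m n hmn => Nat.one_div_le_one_div hmn
  have hrlim : Tendsto r atTop (𝓝[>] 0) := tendsto_nhdsWithin_iff.2
    ⟨tendsto_one_div_add_atTop_nhds_zero_nat, Eventually.of_forall hrpos⟩
  have hχm : Measurable χ := hχ.contDiff.continuous.measurable
  have hlim1 : Tendsto (fun n => ∫⁻ ζ, ENNReal.ofReal (χ ζ) *
      ENNReal.ofReal (25 - smoothLog (r n) z ζ) ∂μ) atTop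
      (𝓝 (∫⁻ ζ, ENNReal.ofReal (χ ζ) * logDefect z ζ ∂μ)) := by
    refine lintegral_tendsto_of_tendsto_of_monotone (fun n => ?_) ?_ ?_
    · have := (contDiff_smoothLog (hrpos n) z).continuous.measurable
      fun_prop
    · refine ae_of_all _ fun ζ m n hmn => ?_
      refine mul_le_mul_right (ENNReal.ofReal_le_ofReal ?_) _
      have := smoothLog_mono (hrpos n) (hranti hmn) z ζ
      linarith
    · refine ae_of_all _ fun ζ => ?_
      exact ENNReal.Tendsto.const_mul ((tendsto_ofReal_sub_smoothLog z ζ).comp hrlim)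
        (.inr ENNReal.ofReal_ne_top)
  have hzU : ball (0 : ℂ) 4 ∈ 𝓝 z :=
    isOpen_ball.mem_nhds (ball_subset_ball (by norm_num) hz)
  have hχz : ∀ᶠ ζ in 𝓝 z, χ ζ = 1 := by
    filter_upwards [isOpen_ball.mem_nhds (ball_subset_ball (by norm_num) hz :
      z ∈ ball (0 : ℂ) (13 / 4))] with ζ hζ using hχ.eq_one ζ hζ
  have hlim2 := (hv.tendsto_lintegral_radialKernel hfin hzU hχ.le_one hχz).comp hrlim
  have hlim3 := (hv.tendsto_integral_cutoffKernel hfin hχ hz).comp hrlim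
  have heq : ∀ n, ((∫⁻ ζ, ENNReal.ofReal (χ ζ) *
      ENNReal.ofReal (25 - smoothLog (r n) z ζ) ∂μ : ENNReal) : EReal) =
      ((25 * (∫ ζ, χ ζ ∂μ) + ∫ ζ, (v ζ).toReal * cutoffKernel χ (r n) z ζ : ℝ) : EReal) +
      ((∫⁻ ζ, v ζ * ENNReal.ofReal (χ ζ * radialKernel (r n) ‖ζ - z‖) : ENNReal) : EReal) := by
    intro n
    have hK := contDiff_smoothLog (hrpos n) z
    have hnn : ∀ ζ, 0 ≤ χ ζ * (25 - smoothLog (r n) z ζ) := fun ζ => by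
      by_cases hζ : ζ ∈ closedBall (0 : ℂ) (7 / 2)
      · exact mul_nonneg (hχ.nonneg ζ) (by linarith [smoothLog_le (hrpos n) (hr1 n) hz hζ])
      · rw [hχ.eq_zero hζ, zero_mul]
    have hint : Integrable (fun ζ => χ ζ * (25 - smoothLog (r n) z ζ)) μ :=
      (hχ.contDiff.continuous.mul (continuous_const.sub
        hK.continuous)).integrable_of_hasCompactSupport hχ.hasCompactSupport.mul_right
    have hrk : Continuous fun ζ => χ ζ * radialKernel (r n) ‖ζ - z‖ :=
      hχ.contDiff.continuous.mul ((continuous_radialKernel (hrpos n)).comp (by fun_prop))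
    obtain ⟨B, hB⟩ := hrk.bounded_above_of_compact_support hχ.hasCompactSupport.mul_right
    have hNfin : ∫⁻ ζ, v ζ * ENNReal.ofReal (χ ζ * radialKernel (r n) ‖ζ - z‖) ≠ ⊤ := by
      refine ne_top_of_le_ne_top (ENNReal.mul_ne_top hfin (ENNReal.ofReal_ne_top (r := B))) ?_
      rw [← lintegral_mul_const _ hv.measurable]
      refine lintegral_mono fun ζ => ?_
      gcongr
      exact (le_abs_self _).trans (hB ζ)
    have h1 : ∫⁻ ζ, ENNReal.ofReal (χ ζ) * ENNReal.ofReal (25 - smoothLog (r n) z ζ) ∂μ =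
        ENNReal.ofReal (∫ ζ, χ ζ * (25 - smoothLog (r n) z ζ) ∂μ) := by
      rw [ofReal_integral_eq_lintegral_ofReal hint (ae_of_all _ hnn)]
      refine lintegral_congr fun ζ => ?_
      rw [ENNReal.ofReal_mul (hχ.nonneg ζ)]
    have h2 := hv.integral_toReal_mul hfin hrk
      (fun ζ => mul_nonneg (hχ.nonneg ζ) (radialKernel_nonneg _ _))
    rw [h1, EReal.coe_ennreal_ofReal, max_eq_left (integral_nonneg hnn),
      hμ.integral_mul_sub_smoothLog hv hfin hχ ⟨hrpos n, hr1 n⟩ hz, h2,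
      ← EReal.coe_ennreal_toReal hNfin, ← EReal.coe_add]
    congr 1
    ring
  have hL := (continuous_coe_ennreal_ereal.tendsto _).comp hlim1
  have hR1 : Tendsto (fun n => ((25 * (∫ ζ, χ ζ ∂μ) +
      ∫ ζ, (v ζ).toReal * cutoffKernel χ (r n) z ζ : ℝ) : EReal)) atTop
      (𝓝 ((25 * (∫ ζ, χ ζ ∂μ) + ∫ ζ, (v ζ).toReal * cutoffKernel χ 0 z ζ : ℝ) : EReal)) :=
    (continuous_coe_real_ereal.tendsto _).comp (tendsto_const_nhds.add hlim3)
  have hR2 := (continuous_coe_ennreal_ereal.tendsto _).comp hlim2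
  have hR := (EReal.continuousAt_add (p := (((25 * (∫ ζ, χ ζ ∂μ) +
    ∫ ζ, (v ζ).toReal * cutoffKernel χ 0 z ζ : ℝ) : EReal), (v z : EReal)))
    (.inl (EReal.coe_ne_top _)) (.inl (EReal.coe_ne_bot _))).tendsto.comp (hR1.prodMk_nhds hR2)
  exact tendsto_nhds_unique hL (hR.congr fun n => (heq n).symm)

/-! ### Harmonic remainders -/

theorem re_log_one_sub_div_add_log {z ζ : ℂ} (h : ‖z‖ < ‖ζ‖) :
    (Complex.log (1 - z / ζ) + (Real.log ‖ζ‖ : ℂ)).re = Real.log ‖ζ - z‖ := by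
  have hζ : ζ ≠ 0 := norm_pos_iff.1 ((norm_nonneg z).trans_lt h)
  have hζz : ζ - z ≠ 0 := fun h0 => by
    rw [sub_eq_zero.1 h0] at h
    exact lt_irrefl _ h
  have h1 : 1 - z / ζ = (ζ - z) / ζ := by field_simp
  rw [h1, Complex.add_re, Complex.log_re, Complex.ofReal_re, norm_div,
    Real.log_div (norm_ne_zero_iff.2 hζz) (norm_ne_zero_iff.2 hζ)]
  ring

theorem one_sub_div_mem_slitPlane {z ζ : ℂ} (h : ‖z‖ < ‖ζ‖) :
    1 - z / ζ ∈ Complex.slitPlane := by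
  have hζ : 0 < ‖ζ‖ := (norm_nonneg z).trans_lt h
  left
  have h1 : ‖z / ζ‖ < 1 := by rwa [norm_div, div_lt_one hζ]
  have := (Complex.abs_re_le_norm (z / ζ)).trans_lt h1
  rw [Complex.sub_re, Complex.one_re]
  linarith [(abs_lt.1 this).2]

/-- Superpositions of `Re (1 / (ζ - z))`-type dipoles and logarithmic charges located in the annulus
`3 ≤ |ζ| ≤ 4` are harmonic inside the disk of radius `3`, being real parts of holomorphic
functions. -/
theorem harmonicOnNhd_integral_dipole_add_log {ν : Measure ℂ}
    (hν : ∀ᵐ ζ ∂ν, 3 ≤ ‖ζ‖ ∧ ‖ζ‖ ≤ 4) {p : ℂ → ℂ} (hp : Integrable p ν) {q : ℂ → ℝ}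
    (hq : Integrable q ν) :
    InnerProductSpace.HarmonicOnNhd
      (fun z => ∫ ζ, ((p ζ / (ζ - z)).re + q ζ * Real.log ‖ζ - z‖) ∂ν) (ball 0 3) := by
  set F : ℂ → ℂ → ℂ := fun z ζ => p ζ * (ζ - z)⁻¹ +
    (q ζ : ℂ) * (Complex.log (1 - z / ζ) + (Real.log ‖ζ‖ : ℂ)) with hF
  set F' : ℂ → ℂ → ℂ := fun z ζ => p ζ * ((ζ - z)⁻¹) ^ 2 - (q ζ : ℂ) * (ζ - z)⁻¹ with hF'
  have hqc : Integrable (fun ζ => (q ζ : ℂ)) ν := hq.ofReal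
  have hmeas : ∀ z, AEStronglyMeasurable (F z) ν := fun z =>
    (hp.aestronglyMeasurable.mul
      (Measurable.aestronglyMeasurable (by fun_prop))).add
      (hqc.aestronglyMeasurable.mul (Measurable.aestronglyMeasurable (by fun_prop)))
  have hint : ∀ z ∈ ball (0 : ℂ) 3, Integrable (F z) ν := by
    intro z hz
    rw [mem_ball_zero_iff] at hz
    have hK : IsCompact (closedBall (0 : ℂ) 4 \ ball 0 3) :=
      (isCompact_closedBall (0 : ℂ) 4).diff isOpen_ball
    have hKmem : ∀ ζ ∈ closedBall (0 : ℂ) 4 \ ball 0 3, ‖z‖ < ‖ζ‖ := fun ζ hζ => by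
      have := hζ.2
      rw [mem_ball_zero_iff, not_lt] at this
      linarith
    have hK0 : ∀ ζ ∈ closedBall (0 : ℂ) 4 \ ball 0 3, ζ ≠ 0 := fun ζ hζ =>
      norm_pos_iff.1 ((norm_nonneg z).trans_lt (hKmem ζ hζ))
    have hKs : ∀ ζ ∈ closedBall (0 : ℂ) 4 \ ball 0 3, ζ - z ≠ 0 := fun ζ hζ h0 => by
      have := hKmem ζ hζ
      rw [sub_eq_zero.1 h0] at this
      exact lt_irrefl _ this
    have hc1 : ContinuousOn (fun ζ : ℂ => (ζ - z)⁻¹) (closedBall (0 : ℂ) 4 \ ball 0 3) :=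
      (continuousOn_id.sub continuousOn_const).inv₀ hKs
    have hc2 : ContinuousOn (fun ζ : ℂ => Complex.log (1 - z / ζ) + (Real.log ‖ζ‖ : ℂ))
        (closedBall (0 : ℂ) 4 \ ball 0 3) := by
      refine ContinuousOn.add (ContinuousOn.clog ?_ fun ζ hζ =>
        one_sub_div_mem_slitPlane (hKmem ζ hζ)) ?_
      · exact continuousOn_const.sub (continuousOn_const.div continuousOn_id hK0)
      · exact Complex.continuous_ofReal.comp_continuousOn
          (continuous_norm.continuousOn.log fun ζ hζ => norm_ne_zero_iff.2 (hK0 ζ hζ))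
    obtain ⟨B1, hB1⟩ := hK.exists_bound_of_continuousOn hc1
    obtain ⟨B2, hB2⟩ := hK.exists_bound_of_continuousOn hc2
    have hae : ∀ᵐ ζ ∂ν, ζ ∈ closedBall (0 : ℂ) 4 \ ball 0 3 := hν.mono fun ζ h => by
      simpa using ⟨h.2, h.1⟩
    exact (hp.mul_bdd (c := B1) (Measurable.aestronglyMeasurable (by fun_prop))
      (hae.mono hB1)).add (hqc.mul_bdd (c := B2)
      (Measurable.aestronglyMeasurable (by fun_prop)) (hae.mono hB2))
  have hdiff : DifferentiableOn ℂ (fun z => ∫ ζ, F z ζ ∂ν) (ball 0 3) := by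
    intro z₀ hz₀
    have hz₀' : ‖z₀‖ < 3 := by simpa using hz₀
    obtain ⟨ρ, hρ1, hρ2⟩ := exists_between hz₀'
    have hsub : ∀ᵐ ζ ∂ν, ∀ z ∈ ball (0 : ℂ) ρ, 3 - ρ ≤ ‖ζ - z‖ ∧ ‖z‖ < ‖ζ‖ :=
      hν.mono fun ζ hζ z hz => by
        rw [mem_ball_zero_iff] at hz
        have := norm_sub_norm_le ζ z
        constructor <;> linarith [hζ.1]
    have h3ρ : 0 < 3 - ρ := by linarith
    have := (hasDerivAt_integral_of_dominated_loc_of_deriv_le (μ := ν) (F := F) (F' := F')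
      (x₀ := z₀) (s := ball 0 ρ)
      (bound := fun ζ => ‖p ζ‖ * ((3 - ρ)⁻¹) ^ 2 + ‖(q ζ : ℂ)‖ * (3 - ρ)⁻¹)
      (isOpen_ball.mem_nhds (by simpa using hρ1)) (Eventually.of_forall hmeas)
      (hint z₀ hz₀) ?_ ?_ ?_ ?_).2
    · exact this.differentiableAt.differentiableWithinAt
    · exact (hp.aestronglyMeasurable.mul (Measurable.aestronglyMeasurable (by fun_prop))).sub
        (hqc.aestronglyMeasurable.mul (Measurable.aestronglyMeasurable (by fun_prop)))
    · refine hsub.mono fun ζ hζ z hz => ?_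
      refine (norm_sub_le _ _).trans ?_
      rw [norm_mul, norm_mul, norm_pow, norm_inv]
      have := (hζ z hz).1
      gcongr
    · exact (hp.norm.mul_const _).add (hqc.norm.mul_const _)
    · refine hsub.mono fun ζ hζ z hz => ?_
      obtain ⟨h1, h2⟩ := hζ z hz
      have hζz : ζ - z ≠ 0 := norm_pos_iff.1 (h3ρ.trans_le h1)
      have hζ0 : ζ ≠ 0 := norm_pos_iff.1 ((norm_nonneg z).trans_lt h2)
      have d1 : HasDerivAt (fun z : ℂ => (ζ - z)⁻¹) (((ζ - z)⁻¹) ^ 2) z := by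
        refine (((hasDerivAt_id z).const_sub ζ).fun_inv hζz).congr_deriv ?_
        simp [div_eq_mul_inv]
      have d2 : HasDerivAt (fun z : ℂ => Complex.log (1 - z / ζ) + (Real.log ‖ζ‖ : ℂ))
          (-(ζ - z)⁻¹) z := by
        refine ((((hasDerivAt_id z).div_const ζ).const_sub 1).clog
          (one_sub_div_mem_slitPlane h2)).add_const _ |>.congr_deriv ?_
        have h3 : 1 - z / ζ = (ζ - z) / ζ := by field_simp
        simp only [id]
        rw [h3]
        field_simp
      refine ((d1.const_mul (p ζ)).add (d2.const_mul (q ζ : ℂ))).congr_deriv ?_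
      simp only [hF']
      ring
  intro z hz
  have han : AnalyticAt ℂ (fun z => ∫ ζ, F z ζ ∂ν) z :=
    hdiff.analyticAt (isOpen_ball.mem_nhds hz)
  refine (InnerProductSpace.harmonicAt_congr_nhds ?_).1 han.harmonicAt_re
  filter_upwards [isOpen_ball.mem_nhds hz] with w hw
  have h1 : (∫ ζ, F w ζ ∂ν).re = ∫ ζ, (F w ζ).re ∂ν :=
    (Complex.reCLM.integral_comp_comm (hint w hw)).symm
  rw [h1]
  refine integral_congr_ae (hν.mono fun ζ hζ => ?_)
  rw [mem_ball_zero_iff] at hw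
  simp only [hF]
  rw [Complex.add_re, Complex.re_ofReal_mul, re_log_one_sub_div_add_log (by linarith [hζ.1]),
    div_eq_mul_inv]

/-- The cutoff kernel at `s = 0` as the potential of a dipole and a logarithmic charge. -/
theorem cutoffKernel_zero_eq (χ : ℂ → ℝ) (z ζ : ℂ) :
    cutoffKernel χ 0 z ζ =
      (((Real.pi : ℂ)⁻¹ * (fderiv ℝ χ ζ 1 + fderiv ℝ χ ζ Complex.I * Complex.I)) / (ζ - z)).re +
        (2 * Real.pi)⁻¹ * Laplacian.laplacian χ ζ * Real.log ‖ζ - z‖ := by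
  have hpi := Real.pi_pos
  have h1 : smoothLog 0 z ζ = Real.log ‖ζ - z‖ := by simp [smoothLog]
  have h2 : ‖ζ - z‖ ^ 2 = Complex.normSq (ζ - z) := Complex.sq_norm _
  have h3 : (Real.pi : ℂ)⁻¹ * (fderiv ℝ χ ζ 1 + fderiv ℝ χ ζ Complex.I * Complex.I) / (ζ - z) =
      ((Real.pi⁻¹ : ℝ) : ℂ) * ((fderiv ℝ χ ζ 1 + fderiv ℝ χ ζ Complex.I * Complex.I) /
        (ζ - z)) := by
    push_cast
    ring
  rw [cutoffKernel, h1, h2, h3, Complex.re_ofReal_mul, Complex.div_re]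
  simp only [Complex.add_re, Complex.ofReal_re, Complex.mul_re, Complex.I_re, Complex.ofReal_im,
    Complex.I_im, Complex.add_im, Complex.mul_im, mul_zero, mul_one, sub_self, add_zero,
    zero_add]
  field_simp
  ring

theorem IsCutoff.harmonicOnNhd_integral_cutoffKernel {χ : ℂ → ℝ} (hχ : IsCutoff χ)
    {w : ℂ → ℝ} (hw : Integrable w) :
    InnerProductSpace.HarmonicOnNhd (fun z => ∫ ζ, w ζ * cutoffKernel χ 0 z ζ) (ball 0 3) := by
  obtain ⟨D, hD0, hD1, hD2⟩ := hχ.exists_derivative_bound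
  have hc : Continuous (fderiv ℝ χ) := hχ.contDiff.continuous_fderiv two_ne_zero
  have hL := hχ.contDiff.continuous_laplacian
  set S : Set ℂ := closedBall 0 4 \ ball 0 3 with hS
  have hSm : MeasurableSet S := measurableSet_closedBall.diff measurableSet_ball
  have hν : ∀ᵐ ζ ∂(volume.restrict S), 3 ≤ ‖ζ‖ ∧ ‖ζ‖ ≤ 4 := by
    filter_upwards [ae_restrict_mem hSm] with ζ hζ
    simpa [hS, and_comm] using hζ
  have hp : Integrable (fun ζ => (w ζ : ℂ) * ((Real.pi : ℂ)⁻¹ *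
      (fderiv ℝ χ ζ 1 + fderiv ℝ χ ζ Complex.I * Complex.I))) (volume.restrict S) := by
    refine (hw.restrict.ofReal (𝕜 := ℂ)).mul_bdd (c := ‖(Real.pi : ℂ)⁻¹‖ * (D + D))
      (Continuous.aestronglyMeasurable (by fun_prop)) (ae_of_all _ fun ζ => ?_)
    rw [norm_mul]
    gcongr
    refine (norm_add_le _ _).trans (add_le_add ?_ ?_)
    · rw [Complex.norm_real]
      have := (fderiv ℝ χ ζ).le_opNorm 1
      rw [norm_one, mul_one] at this
      exact this.trans (hD1 ζ)
    · rw [norm_mul, Complex.norm_I, mul_one, Complex.norm_real]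
      have := (fderiv ℝ χ ζ).le_opNorm Complex.I
      rw [Complex.norm_I, mul_one] at this
      exact this.trans (hD1 ζ)
  have hq : Integrable (fun ζ => w ζ * ((2 * Real.pi)⁻¹ * Laplacian.laplacian χ ζ))
      (volume.restrict S) := by
    refine hw.restrict.mul_bdd (c := ‖(2 * Real.pi)⁻¹‖ * D)
      (Continuous.aestronglyMeasurable (by fun_prop)) (ae_of_all _ fun ζ => ?_)
    rw [norm_mul]
    gcongr
    exact hD2 ζ
  have hH := harmonicOnNhd_integral_dipole_add_log hν hp hq
  convert hH using 1
  funext z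
  rw [← setIntegral_eq_integral_of_forall_compl_eq_zero (s := S)]
  · congr 1
    funext ζ
    rw [cutoffKernel_zero_eq, mul_add, ← Complex.re_ofReal_mul, ← mul_div_assoc]
    ring
  · intro ζ hζ
    rw [hχ.cutoffKernel_eq_zero, mul_zero]
    by_cases h : ζ ∈ ball (0 : ℂ) 3
    · exact .inl (ball_subset_ball (by norm_num) h)
    · refine .inr fun h' => hζ ⟨closedBall_subset_closedBall (by norm_num) h', h⟩

theorem IsCutoff.harmonicOnNhd_setIntegral_log {χ : ℂ → ℝ} (hχ : IsCutoff χ) (μ : Measure ℂ)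
    [IsFiniteMeasureOnCompacts μ] :
    InnerProductSpace.HarmonicOnNhd
      (fun z => ∫ ζ in (ball 0 3)ᶜ, χ ζ * Real.log ‖ζ - z‖ ∂μ) (ball 0 3) := by
  set S : Set ℂ := closedBall 0 4 \ ball 0 3 with hS
  have hSm : MeasurableSet S := measurableSet_closedBall.diff measurableSet_ball
  have hν : ∀ᵐ ζ ∂(μ.restrict S), 3 ≤ ‖ζ‖ ∧ ‖ζ‖ ≤ 4 := by
    filter_upwards [ae_restrict_mem hSm] with ζ hζ
    simpa [hS, and_comm] using hζ
  have hq : Integrable χ (μ.restrict S) :=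
    (hχ.contDiff.continuous.integrable_of_hasCompactSupport hχ.hasCompactSupport).restrict
  have hH := harmonicOnNhd_integral_dipole_add_log hν (p := 0) (integrable_zero _ _ _) hq
  convert hH using 1
  funext z
  have hSsub : S ⊆ (ball (0 : ℂ) 3)ᶜ := fun ζ hζ => hζ.2
  simp only [Pi.zero_apply, zero_div, Complex.zero_re, zero_add]
  refine (setIntegral_eq_of_subset_of_forall_sdiff_eq_zero measurableSet_ball.compl hSsub
    fun ζ hζ => ?_)
  rw [hχ.eq_zero fun h' => hζ.2 ⟨closedBall_subset_closedBall (by norm_num) h', hζ.1⟩, zero_mul]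

/-! ### The Riesz representation with bounds -/

/-- The super-mean value property on the whole disk bounds the integral by the value at the centre. -/
theorem IsNonnegSuperharmonicOn.lintegral_le {v : ℂ → ENNReal}
    (hv : IsNonnegSuperharmonicOn v (ball 0 4)) (hv0 : ∀ z ∉ ball (0 : ℂ) 4, v z = 0) {A : ℝ}
    (hA : v 0 ≤ ENNReal.ofReal A) : ∫⁻ ζ, v ζ ≤ ENNReal.ofReal (16 * Real.pi * A) := by
  have hpi := Real.pi_pos
  have h1 : ∫⁻ ζ, v ζ = ∫⁻ ζ in ball (0 : ℂ) 4, v ζ := by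
    rw [← lintegral_indicator measurableSet_ball]
    congr 1
    funext ζ
    by_cases h : ζ ∈ ball (0 : ℂ) 4
    · rw [indicator_of_mem h]
    · rw [indicator_of_notMem h, hv0 ζ h]
  have h2 : volume (ball (0 : ℂ) 4) = ENNReal.ofReal (16 * Real.pi) := by
    rw [Complex.volume_ball, ← ENNReal.ofReal_pow (by norm_num), ← ENNReal.ofReal_coe_nnreal,
      ← ENNReal.ofReal_mul (by norm_num)]
    norm_num
  rw [h1, ENNReal.ofReal_mul (by positivity), ← h2, mul_comm]
  exact (hv.lintegral_ball_le subset_rfl).trans (mul_le_mul_left hA _)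

theorem IsNonnegSuperharmonicOn.exists_isRieszMeasure {v : ℂ → ENNReal}
    (hv : IsNonnegSuperharmonicOn v (ball 0 4)) (hfin : ∫⁻ ζ, v ζ ≠ ⊤) :
    ∃ μ : Measure ℂ, IsFiniteMeasureOnCompacts μ ∧ IsRieszMeasure v μ := by
  let χ : ContDiffBump (0 : ℂ) := ⟨29 / 8, 15 / 4, by norm_num, by norm_num⟩
  obtain ⟨μ, hμ, h⟩ := hv.exists_measure_eq_laplacian hfin isOpen_ball (χ := χ) χ.contDiff
    χ.hasCompactSupport (χ.tsupport_eq.le.trans (closedBall_subset_ball (by norm_num)))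
    (fun _ => χ.nonneg)
  refine ⟨μ, hμ, fun f hf hfs => h f hf ?_ fun z => ?_⟩
  · exact (isCompact_closedBall (0 : ℂ) (7 / 2)).of_isClosed_subset (isClosed_tsupport f) hfs
  · by_cases hz : z ∈ closedBall (0 : ℂ) (7 / 2)
    · rw [χ.one_of_mem_closedBall (closedBall_subset_closedBall (by norm_num) hz), one_mul]
    · rw [image_eq_zero_of_notMem_tsupport fun h => hz (hfs h), mul_zero]

/-- The logarithmic potential in terms of the nonnegative function `logDefect`. -/
theorem logPotential_eq_sub_lintegral_logDefect (μ : Measure ℂ)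
    [IsFiniteMeasure (μ.restrict (ball 0 3))] {z : ℂ} (hz : z ∈ ball (0 : ℂ) 3) :
    logPotential (ball 0 3) μ z = ((25 * μ.real (ball 0 3) : ℝ) : EReal) -
      ((∫⁻ ζ in ball 0 3, logDefect z ζ ∂μ : ENNReal) : EReal) := by
  have hm : Measurable fun ζ : ℂ => ENNReal.log ‖z - ζ‖ₑ :=
    ENNReal.continuous_log.measurable.comp (by fun_prop)
  have hle : ∀ᵐ ζ ∂(μ.restrict (ball 0 3)), ENNReal.log ‖z - ζ‖ₑ ≤ ((25 : ℝ) : EReal) := by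
    filter_upwards [ae_restrict_mem measurableSet_ball] with ζ hζ
    by_cases h : ζ = z
    · simp [h]
    · rw [log_enorm_sub h, EReal.coe_le_coe_iff]
      have h0 : 0 < ‖ζ - z‖ := norm_pos_iff.2 (sub_ne_zero.2 h)
      have h1 := Real.log_le_sub_one_of_pos h0
      have h2 := norm_sub_le ζ z
      rw [mem_ball_zero_iff] at hz hζ
      linarith
  rw [logPotential, extIntegral_eq_sub_lintegral hm.aemeasurable hle, measureReal_restrict_apply_univ]
  rfl

/-- Away from the disk of radius `3` the logarithmic kernel is bounded, with a bound depending on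
the distance of `z` to the boundary. -/
theorem abs_log_norm_sub_le {δ : ℝ} (hδ : 0 < δ) {z ζ : ℂ} (hz : z ∈ ball (0 : ℂ) (3 - δ))
    (h1 : ζ ∉ ball (0 : ℂ) 3) (h2 : ζ ∈ closedBall (0 : ℂ) (7 / 2)) :
    |Real.log ‖ζ - z‖| ≤ 7 + δ⁻¹ := by
  simp only [mem_ball_zero_iff, mem_closedBall_zero_iff, not_lt] at hz h1 h2
  have h3 := norm_sub_le ζ z
  have h4 := norm_sub_norm_le ζ z
  have h5 : δ ≤ ‖ζ - z‖ := by linarith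
  have h6 := Real.log_le_sub_one_of_pos (hδ.trans_le h5)
  have h7 := Real.one_sub_inv_le_log_of_pos (hδ.trans_le h5)
  have h8 : ‖ζ - z‖⁻¹ ≤ δ⁻¹ := inv_anti₀ hδ h5
  have : 0 < δ⁻¹ := inv_pos.2 hδ
  rw [abs_le]
  constructor <;> linarith

/-- The part of the potential coming from the complement of the disk of radius `3`. -/
theorem IsCutoff.setLIntegral_compl_logDefect {χ : ℂ → ℝ} (hχ : IsCutoff χ) (μ : Measure ℂ)
    [IsFiniteMeasureOnCompacts μ] {z : ℂ} (hz : z ∈ ball (0 : ℂ) 3) :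
    ((∫⁻ ζ in (ball 0 3)ᶜ, ENNReal.ofReal (χ ζ) * logDefect z ζ ∂μ : ENNReal) : EReal) =
      ((25 * (∫ ζ in (ball 0 3)ᶜ, χ ζ ∂μ) -
        ∫ ζ in (ball 0 3)ᶜ, χ ζ * Real.log ‖ζ - z‖ ∂μ : ℝ) : EReal) := by
  have hz3 : ‖z‖ < 3 := by simpa using hz
  have hχi : Integrable χ μ := hχ.contDiff.continuous.integrable_of_hasCompactSupport
    hχ.hasCompactSupport
  have hδ : 0 < (3 - ‖z‖) / 2 := by linarith
  have hzδ : z ∈ ball (0 : ℂ) (3 - (3 - ‖z‖) / 2) := by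
    rw [mem_ball_zero_iff]
    linarith
  have hli : IntegrableOn (fun ζ => χ ζ * Real.log ‖ζ - z‖) (ball 0 3)ᶜ μ := by
    refine Integrable.mono' (hχi.restrict.mul_const (7 + ((3 - ‖z‖) / 2)⁻¹))
      (hχ.contDiff.continuous.measurable.mul (by fun_prop)).aestronglyMeasurable ?_
    filter_upwards [ae_restrict_mem measurableSet_ball.compl] with ζ hζ
    rw [norm_mul, Real.norm_eq_abs, Real.norm_eq_abs, abs_of_nonneg (hχ.nonneg ζ)]
    by_cases h : ζ ∈ closedBall (0 : ℂ) (7 / 2)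
    · exact mul_le_mul_of_nonneg_left (abs_log_norm_sub_le hδ hzδ hζ h) (hχ.nonneg ζ)
    · rw [hχ.eq_zero h, zero_mul, zero_mul]
  have hnn : ∀ᵐ ζ ∂(μ.restrict (ball 0 3)ᶜ), 0 ≤ χ ζ * (25 - Real.log ‖ζ - z‖) := by
    filter_upwards [ae_restrict_mem measurableSet_ball.compl] with ζ hζ
    by_cases h : ζ ∈ closedBall (0 : ℂ) (7 / 2)
    · refine mul_nonneg (hχ.nonneg ζ) ?_
      rw [mem_closedBall_zero_iff] at h
      have hζ' : 3 ≤ ‖ζ‖ := by simpa using hζ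
      have h3 := norm_sub_le ζ z
      have h4 := norm_sub_norm_le ζ z
      have := Real.log_le_sub_one_of_pos (show 0 < ‖ζ - z‖ by linarith)
      linarith
    · rw [hχ.eq_zero h, zero_mul]
  have hint : IntegrableOn (fun ζ => χ ζ * (25 - Real.log ‖ζ - z‖)) (ball 0 3)ᶜ μ := by
    have : (fun ζ => χ ζ * (25 - Real.log ‖ζ - z‖)) =
        fun ζ => χ ζ * 25 - χ ζ * Real.log ‖ζ - z‖ := by
      funext ζ
      ring
    rw [this]
    exact (hχi.restrict.mul_const 25).sub hli
  have h1 : ∫⁻ ζ in (ball 0 3)ᶜ, ENNReal.ofReal (χ ζ) * logDefect z ζ ∂μ =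
      ENNReal.ofReal (∫ ζ in (ball 0 3)ᶜ, χ ζ * (25 - Real.log ‖ζ - z‖) ∂μ) := by
    rw [ofReal_integral_eq_lintegral_ofReal hint hnn]
    refine setLIntegral_congr_fun measurableSet_ball.compl fun ζ hζ => ?_
    have hne : ζ ≠ z := fun h => hζ (h ▸ hz)
    rw [logDefect_of_ne hne, ENNReal.ofReal_mul (hχ.nonneg ζ)]
  rw [h1, EReal.coe_ennreal_ofReal, max_eq_left (integral_nonneg_of_ae hnn),
    ← integral_const_mul, ← integral_sub (hχi.restrict.const_mul 25) hli]
  congr 2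
  funext ζ
  ring

/-- A nonnegative superharmonic function is the potential of its Riesz measure on the disk of
radius `3` up to a harmonic function given by explicit integrals. -/
theorem IsRieszMeasure.coe_sub_eq_logPotential_add {v : ℂ → ENNReal} {μ : Measure ℂ}
    [IsFiniteMeasureOnCompacts μ] (hv : IsNonnegSuperharmonicOn v (ball 0 4))
    (hfin : ∫⁻ ζ, v ζ ≠ ⊤) (hμ : IsRieszMeasure v μ) {χ : ℂ → ℝ} (hχ : IsCutoff χ)
    {z : ℂ} (hz : z ∈ ball (0 : ℂ) 3) (M : ℝ) :
    (M : EReal) - (v z : EReal) = logPotential (ball 0 3) μ z +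
      ((M + (∫ ζ in (ball 0 3)ᶜ, χ ζ * Real.log ‖ζ - z‖ ∂μ) +
        ∫ ζ, (v ζ).toReal * cutoffKernel χ 0 z ζ : ℝ) : EReal) := by
  have hμb : μ (ball (0 : ℂ) 3) < ⊤ :=
    (measure_mono ball_subset_closedBall).trans_lt (isCompact_closedBall (0 : ℂ) 3).measure_lt_top
  have : IsFiniteMeasure (μ.restrict (ball (0 : ℂ) 3)) := ⟨by simpa using hμb⟩
  have hχi : Integrable χ μ := hχ.contDiff.continuous.integrable_of_hasCompactSupport
    hχ.hasCompactSupport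
  have hχ1 : ∀ ζ ∈ ball (0 : ℂ) 3, χ ζ = 1 := fun ζ hζ =>
    hχ.eq_one ζ (ball_subset_ball (by norm_num) hζ)
  have hrep := hμ.lintegral_mul_logDefect hv hfin hχ hz
  have hin : ∫⁻ ζ in ball 0 3, ENNReal.ofReal (χ ζ) * logDefect z ζ ∂μ =
      ∫⁻ ζ in ball 0 3, logDefect z ζ ∂μ :=
    setLIntegral_congr_fun measurableSet_ball fun ζ hζ => by simp [hχ1 ζ hζ]
  have hmass : ∫ ζ, χ ζ ∂μ = μ.real (ball 0 3) + ∫ ζ in (ball 0 3)ᶜ, χ ζ ∂μ := by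
    rw [← integral_add_compl (measurableSet_ball (x := (0 : ℂ)) (ε := 3)) hχi,
      setIntegral_congr_fun measurableSet_ball hχ1]
    simp
  rw [← lintegral_add_compl _ (measurableSet_ball (x := (0 : ℂ)) (ε := 3)), hin,
    EReal.coe_ennreal_add, hχ.setLIntegral_compl_logDefect μ hz, hmass] at hrep
  rw [logPotential_eq_sub_lintegral_logDefect μ hz]
  generalize (∫⁻ ζ in ball 0 3, logDefect z ζ ∂μ) = L at *
  generalize (∫ ζ in (ball 0 3)ᶜ, χ ζ * Real.log ‖ζ - z‖ ∂μ) = H at *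
  generalize (∫ ζ in (ball 0 3)ᶜ, χ ζ ∂μ) = m at *
  generalize (∫ ζ, (v ζ).toReal * cutoffKernel χ 0 z ζ) = E at *
  generalize μ.real (ball 0 3) = a at *
  generalize v z = w at *
  have e : ∀ x : NNReal, (((x : ENNReal)) : EReal) = ((x : ℝ) : EReal) := fun x => rfl
  induction L using ENNReal.recTopCoe with
  | top =>
    induction w using ENNReal.recTopCoe with
    | top => simp
    | coe w =>
      rw [e, ← EReal.coe_add, EReal.coe_ennreal_top, EReal.top_add_coe] at hrep
      exact absurd hrep.symm (EReal.coe_ne_top _)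
  | coe L =>
    induction w using ENNReal.recTopCoe with
    | top =>
      rw [e, ← EReal.coe_add, EReal.coe_ennreal_top, EReal.coe_add_top] at hrep
      exact absurd hrep (EReal.coe_ne_top _)
    | coe w =>
      rw [e, e, ← EReal.coe_add, ← EReal.coe_add, EReal.coe_eq_coe_iff] at hrep
      rw [e, e, ← EReal.coe_sub, ← EReal.coe_sub, ← EReal.coe_add, EReal.coe_eq_coe_iff]
      linarith

end

theorem mainTheorem9 :
    ∃ (C₀ : ℝ) (C : ℝ → ℝ), 0 < C₀ ∧ (∀ δ ∈ Ioo (0 : ℝ) 1, 0 < C δ) ∧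
      ∀ (Ω : Set ℂ) (u : ℂ → EReal) (M m : ℝ),
        IsOpen Ω → closedBall (0 : ℂ) 4 ⊆ Ω → IsSubharmonicOn u Ω →
        (∀ z ∈ closedBall (0 : ℂ) 4, u z ≤ (M : EReal)) → (m : EReal) ≤ u 0 →
        ∃ (μ : Measure ℂ) (h : ℂ → ℝ),
          IsFiniteMeasure μ ∧ μ (ball (0 : ℂ) 3)ᶜ = 0 ∧
          InnerProductSpace.HarmonicOnNhd h (ball (0 : ℂ) 3) ∧
          (∀ z ∈ ball (0 : ℂ) 3, u z = logPotential (ball (0 : ℂ) 3) μ z + (h z : EReal)) ∧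
          μ (ball (0 : ℂ) 3) ≤ ENNReal.ofReal (C₀ * (M - m)) ∧
          (∀ z ∈ ball (0 : ℂ) 2, |h z - M| ≤ C₀ * (M - m)) ∧
          (∀ δ ∈ Ioo (0 : ℝ) 1, ∀ z ∈ ball (0 : ℂ) (3 - δ), |h z - M| ≤ C δ * (M - m)) := by
  have hpi := Real.pi_pos
  obtain ⟨χ, hχ⟩ := exists_isCutoff
  obtain ⟨D, hD0, -, hD⟩ := hχ.exists_derivative_bound
  obtain ⟨C, hC0, hC⟩ := hχ.exists_abs_cutoffKernel_le
  -- Relative to `M - m`, the mass of the Riesz measure is at most `8 D` and the integral of `v` at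
  -- most `16 π`; the first constant is the case `δ = 1` of the second.
  refine ⟨(7 + 1⁻¹) * (8 * D) + C * (16 * Real.pi) + 1,
    fun δ => (7 + δ⁻¹) * (8 * D) + C * (16 * Real.pi) + 1, by positivity,
    fun δ hδ => by have := hδ.1; positivity, fun Ω u M m hΩ hball hu hM hm => ?_⟩
  set v : ℂ → ENNReal := (ball (0 : ℂ) 4).indicator fun z => ((M : EReal) - u z).toENNReal
    with hvdef
  have hv : IsNonnegSuperharmonicOn v (ball 0 4) :=
    hu.isNonnegSuperharmonicOn (ball_subset_closedBall.trans hball)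
      fun z hz => hM z (ball_subset_closedBall hz)
  have hmM : 0 ≤ M - m := by
    have := hm.trans (hM 0 (mem_closedBall_self (by norm_num)))
    rw [EReal.coe_le_coe_iff] at this
    linarith
  have hv0 : v 0 ≤ ENNReal.ofReal (M - m) := by
    rw [hvdef, indicator_of_mem (mem_ball_self (by norm_num))]
    have h := EReal.toENNReal_le_toENNReal (EReal.sub_le_sub (le_refl (M : EReal)) hm)
    rwa [← EReal.coe_sub, EReal.toENNReal_of_ne_top (EReal.coe_ne_top _),
      EReal.toReal_coe] at h
  have hvint := hv.lintegral_le (fun z hz => indicator_of_notMem hz _) hv0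
  have hfin : ∫⁻ ζ, v ζ ≠ ⊤ := ne_top_of_le_ne_top ENNReal.ofReal_ne_top hvint
  have hvI : ∫ ζ, (v ζ).toReal ≤ 16 * Real.pi * (M - m) := by
    rw [integral_toReal hv.measurable.aemeasurable (ae_lt_top hv.measurable hfin)]
    exact ENNReal.toReal_le_of_le_ofReal (by positivity) hvint
  obtain ⟨μ, hμc, hμ⟩ := hv.exists_isRieszMeasure hfin
  have hχi : Integrable χ μ := hχ.contDiff.continuous.integrable_of_hasCompactSupport
    hχ.hasCompactSupport
  have hbd : ∀ (g : ℂ → ℝ) (B : ℝ), 0 ≤ B → (∀ ζ, |g ζ| ≤ B) →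
      |∫ ζ, (v ζ).toReal * g ζ| ≤ B * (16 * Real.pi * (M - m)) := by
    intro g B hB hg
    rw [← Real.norm_eq_abs]
    calc ‖∫ ζ, (v ζ).toReal * g ζ‖ ≤ ∫ ζ, ‖(v ζ).toReal * g ζ‖ := norm_integral_le_integral_norm _
      _ ≤ ∫ ζ, (v ζ).toReal * B := by
          refine integral_mono_of_nonneg (ae_of_all _ fun _ => norm_nonneg _)
            ((hv.integrable_toReal hfin).mul_const B) (ae_of_all _ fun ζ => ?_)
          simp only [norm_mul, Real.norm_eq_abs, ENNReal.abs_toReal]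
          gcongr
          exact hg ζ
      _ = B * ∫ ζ, (v ζ).toReal := by rw [integral_mul_const, mul_comm]
      _ ≤ _ := by gcongr
  have hmass : ∫ ζ, χ ζ ∂μ ≤ 8 * D * (M - m) := by
    rw [hμ χ hχ.contDiff hχ.tsupport_subset]
    have h1 := (abs_le.1 (hbd _ D hD0 hD)).1
    have h2 : (2 * Real.pi)⁻¹ * (D * (16 * Real.pi * (M - m))) = 8 * D * (M - m) := by
      field_simp
      ring
    have h3 : 0 < (2 * Real.pi)⁻¹ := by positivity
    nlinarith
  have hball3 : μ.real (ball 0 3) ≤ ∫ ζ, χ ζ ∂μ := by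
    have h1 : ∫ ζ in ball (0 : ℂ) 3, χ ζ ∂μ = μ.real (ball 0 3) := by
      rw [setIntegral_congr_fun (g := fun _ => (1 : ℝ)) measurableSet_ball fun ζ hζ =>
        hχ.eq_one ζ (ball_subset_ball (by norm_num) hζ)]
      simp
    rw [← h1]
    exact setIntegral_le_integral hχi (ae_of_all _ hχ.nonneg)
  have hμb : μ (ball (0 : ℂ) 3) < ⊤ :=
    (measure_mono ball_subset_closedBall).trans_lt (isCompact_closedBall (0 : ℂ) 3).measure_lt_top
  set H : ℂ → ℝ := fun z => ∫ ζ in (ball 0 3)ᶜ, χ ζ * Real.log ‖ζ - z‖ ∂μ with hHdef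
  set E : ℂ → ℝ := fun z => ∫ ζ, (v ζ).toReal * cutoffKernel χ 0 z ζ with hEdef
  -- Both correction terms are controlled by `M - m`, the second uniformly in `z`.
  have hHE : ∀ δ : ℝ, 0 < δ → ∀ z ∈ ball (0 : ℂ) (3 - δ), |M + H z + E z - M| ≤
      ((7 + δ⁻¹) * (8 * D) + C * (16 * Real.pi) + 1) * (M - m) := by
    intro δ hδ z hz
    have hδi : 0 < δ⁻¹ := inv_pos.2 hδ
    have hz3 : z ∈ ball (0 : ℂ) 3 := ball_subset_ball (by linarith) hz
    have h1 : |E z| ≤ C * (16 * Real.pi * (M - m)) :=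
      hbd _ C hC0 (hC 0 (by simp) z hz3)
    have h2 : |H z| ≤ (7 + δ⁻¹) * (8 * D * (M - m)) := by
      rw [← Real.norm_eq_abs]
      calc ‖H z‖ ≤ ∫ ζ in (ball 0 3)ᶜ, ‖χ ζ * Real.log ‖ζ - z‖‖ ∂μ :=
            norm_integral_le_integral_norm _
        _ ≤ ∫ ζ in (ball 0 3)ᶜ, (7 + δ⁻¹) * χ ζ ∂μ := by
            refine integral_mono_of_nonneg (ae_of_all _ fun _ => norm_nonneg _)
              (hχi.restrict.const_mul _) ?_
            filter_upwards [ae_restrict_mem measurableSet_ball.compl] with ζ hζ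
            rw [norm_mul, Real.norm_eq_abs, Real.norm_eq_abs, abs_of_nonneg (hχ.nonneg ζ), mul_comm]
            by_cases h : ζ ∈ closedBall (0 : ℂ) (7 / 2)
            · exact mul_le_mul_of_nonneg_right (abs_log_norm_sub_le hδ hz hζ h) (hχ.nonneg ζ)
            · rw [hχ.eq_zero h, mul_zero, mul_zero]
        _ = (7 + δ⁻¹) * ∫ ζ in (ball 0 3)ᶜ, χ ζ ∂μ := integral_const_mul _ _
        _ ≤ (7 + δ⁻¹) * (8 * D * (M - m)) := by
            gcongr
            exact (setIntegral_le_integral hχi (ae_of_all _ hχ.nonneg)).trans hmass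
    have h3 : M + H z + E z - M = H z + E z := by ring
    rw [h3]
    refine (abs_add_le _ _).trans ?_
    linarith
  refine ⟨μ.restrict (ball 0 3), fun z => M + H z + E z, ⟨by simpa using hμb⟩, ?_, ?_, ?_, ?_, ?_,
    fun δ hδ => hHE δ hδ.1⟩
  · rw [Measure.restrict_apply measurableSet_ball.compl]
    simp
  · exact ((InnerProductSpace.harmonicOnNhd_const M).add (hχ.harmonicOnNhd_setIntegral_log μ)).add
      (hχ.harmonicOnNhd_integral_cutoffKernel (hv.integrable_toReal hfin))
  · intro z hz
    have hz4 : z ∈ ball (0 : ℂ) 4 := ball_subset_ball (by norm_num) hz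
    have h1 : logPotential (ball 0 3) (μ.restrict (ball 0 3)) z = logPotential (ball 0 3) μ z := by
      rw [logPotential, logPotential, Measure.restrict_restrict measurableSet_ball, inter_self]
    rw [h1, ← hμ.coe_sub_eq_logPotential_add hv hfin hχ hz M, hvdef, indicator_of_mem hz4,
      EReal.coe_sub_toENNReal_coe_sub (hM z (ball_subset_closedBall hz4))]
  · rw [Measure.restrict_apply_self, ← ofReal_measureReal hμb.ne]
    refine ENNReal.ofReal_le_ofReal ((hball3.trans hmass).trans ?_)
    gcongr
    have : 0 ≤ C * (16 * Real.pi) := by positivity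
    linarith
  · intro z hz
    exact hHE 1 one_pos z (by norm_num; simpa using hz)
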